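/- For positive integers $s_1,\dots,s_k$ and $0\le x\le 1$ (with $x=s_1=1$ excluded) let $$\zeta_x(s_1,\dots,s_k)=\sum_{n_1>\cdots>n_k>0} x^{n_1}\prod_{j=1}^k n_j^{-s_j},\qquad \zeta_x()=1,\qquad \zeta=\zeta_1,$$ and let $\{s_1,\dots,s_k\}^n$ denote the string $s_1,\dots,s_k$ repeated $n$ times. Let $F(a,b;c;x)=\sum_{n\ge 0}x^n\prod_{j=0}^{n-1}\frac{(a+j)(b+j)}{(1+j)(c+j)}$ be the Gaussian hypergeometric series, let $\psi=\Gamma'/\Gamma$, and put $$Y_1(x,z)=F(z,-z;1;x),\qquad Y_2(x,z)=(1-x)F(1+z,1-z;2;1-x),$$ $$G(z)=\tfrac14\{\psi(1+iz)+\psi(1-iz)-\psi(1+z)-\psi(1-z)\}.$$ Then for $0\le x\le 1$ and $z\in\mathbf{C}$ with $|z|<1$, $$\sum_{n=0}^\infty(-1)^n z^{4n+2}4^n\zeta_x(3,\{1,3\}^n)=G(z)Y_1(x,z)Y_1(x,iz)-\frac{Y_1(x,iz)Y_2(x,z)}{4Y_1(1,z)}+\frac{Y_1(x,z)Y_2(x,iz)}{4Y_1(1,iz)},$$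 where for $x=0$, at which the series for $Y_2$ diverges, the right-hand side is understood as its limit for $x\to0^+$. Moreover, for every integer $n\ge 0$, $$\zeta(3,\{1,3\}^n)=4^{-n}\sum_{k=0}^n(-1)^k\zeta(4k+3)\,\zeta(\{4\}^{n-k})=\sum_{k=0}^n\frac{2\pi^{4k}}{(4k+2)!}\left(-\frac14\right)^{n-k}\zeta(4n-4k+3).$$ -/

import Mathlib

noncomputable section

/-- `multiZeta x [s₁, …, s_k]` is `∑_{n₁ > ⋯ > n_k > 0} x ^ n₁ * ∏ⱼ nⱼ ^ (-sⱼ)`;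
for the empty list the only index is the empty tuple and the value is `1`. -/
def multiZeta (x : ℝ) (s : List ℕ) : ℝ :=
  ∑' n : {n : Fin s.length → ℕ // StrictAnti n ∧ ∀ j, 0 < n j},
    (if h : 0 < s.length then x ^ n.1 ⟨0, h⟩ else 1) *
      ∏ j : Fin s.length, ((n.1 j : ℝ) ^ s.get j)⁻¹

/-- The concatenation power of an argument string. -/
def strPow (s : List ℕ) (n : ℕ) : List ℕ := (List.replicate n s).flatten

/-- `Y₁(x, z) = F(z, -z; 1; x)`. -/
def hypY₁ (x : ℝ) (z : ℂ) : ℂ := ordinaryHypergeometric z (-z) (1 : ℂ) (x : ℂ)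

/-- `Y₂(x, z) = (1 - x) F(1 + z, 1 - z; 2; 1 - x)`. The series converges for `0 < x ≤ 1`. -/
def hypY₂ (x : ℝ) (z : ℂ) : ℂ :=
  (1 - (x : ℂ)) * ordinaryHypergeometric (1 + z) (1 - z) (2 : ℂ) (1 - (x : ℂ))

/-- `G(z) = (ψ(1 + iz) + ψ(1 - iz) - ψ(1 + z) - ψ(1 - z)) / 4`. -/
def psiG (z : ℂ) : ℂ :=
  (1 / 4) * (Complex.digamma (1 + Complex.I * z) + Complex.digamma (1 - Complex.I * z)
    - Complex.digamma (1 + z) - Complex.digamma (1 - z))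

/-- The closed form of the generating function. -/
def closedForm (x : ℝ) (z : ℂ) : ℂ :=
  psiG z * hypY₁ x z * hypY₁ x (Complex.I * z)
    - hypY₁ x (Complex.I * z) * hypY₂ x z / (4 * hypY₁ 1 z)
    + hypY₁ x z * hypY₂ x (Complex.I * z) / (4 * hypY₁ 1 (Complex.I * z))

/-- The `n`-th term `(-1)^n z^(4n+2) 4^n ζ_x(3, {1,3}^n)` of the generating function. -/
def genTerm (x : ℝ) (z : ℂ) (n : ℕ) : ℂ :=
  (-1) ^ n * z ^ (4 * n + 2) * 4 ^ n * (multiZeta x (3 :: strPow [1, 3] n) : ℂ)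

end

open Filter Topology Finset Asymptotics

noncomputable section

/-! Let `S` be the generating function as a function of `x`. Applying `x d/dx` to a multiple
polylogarithm lowers a leading exponent above 1, and `(1 - x) d/dx` removes a leading 1. With `S₁ =
x S'`, `S₂ = x S₁'` this gives `(1 - x) S₂' = z² Ω` and `(1 - x) Ω' = -4 z² S`, a linear equation of
order four.

Let `p` and `q` solve the hypergeometric equations with parameters `z` and `iz`, and put `p₁ = x
p'`, `q₁ = x q'`. The four combinations `p q`, `p₁ q + p q₁`, `p₁ q₁`, `p₁ q - p q₁` are carried
into one another by `x d/dx` and `(1 - x) d/dx`, because the two parameters have opposite squares.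
In particular `p q` solves the equation of `S`, and the four combinations pair with `S, S₁, S₂, Ω`
to a quantity independent of `x` (`genPairing_hasDerivAt`). Its value is read off at `x → 0`
(`genPairing_eq`). Two choices of `p` and two of `q` give four linear equations, and the Wronskian
identity `hyp_wronskian` lets them be solved for `S` (`powSum_genCoeff_eq`).

The function `G` enters through the one pairing in which both solutions have a logarithm at 0. The
logarithms cancel and leave the constant terms of `Y₂`, which are derivatives in `c` of the Gauss
sum `F(z, -z; c; 1)` at `c = 1` (`tsum_regCoeff`). The contiguous relation in `c` turns these into
the series of `ψ(1 + z) + ψ(1 - z)` (`psiG_eq`).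

At `x = 1` both `Y₂` vanish, leaving `G(z) Y₁(1,z) Y₁(1,iz)`. Here `G(z) = ∑ ζ(4k+3) z^(4k+2)`,
while `Y₁(1,z) Y₁(1,iz)` is the product of `1 - z⁴/j⁴`. The latter expands either through `ζ({4}^m)`
or through Euler's sine product, and the two evaluations follow by comparing coefficients. -/

/-! ### Power series under `x d/dx` and `(1 - x) d/dx` -/

/-- The sum of the power series with coefficients `a` at the real point `x`. -/
def powSum (a : ℕ → ℂ) (x : ℝ) : ℂ := ∑' m, a m * (x : ℂ) ^ m

theorem summable_powSum {a : ℕ → ℂ} {C : ℝ} (ha : ∀ m, ‖a m‖ ≤ C) {x : ℝ} (hx : |x| < 1) :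
    Summable fun m => a m * (x : ℂ) ^ m := by
  refine Summable.of_norm_bounded (g := fun m => C * |x| ^ m)
    ((summable_geometric_of_lt_one (abs_nonneg x) hx).mul_left C) fun m => ?_
  rw [norm_mul, norm_pow, Complex.norm_real, Real.norm_eq_abs]
  gcongr
  exact ha m

theorem summable_succ_mul_powSum {a : ℕ → ℂ} {C : ℝ} (ha : ∀ m, ‖a m‖ ≤ C) {x : ℝ}
    (hx : |x| < 1) : Summable fun m : ℕ => ((m : ℂ) + 1) * a (m + 1) * (x : ℂ) ^ m := by
  have h1 : Summable fun m : ℕ => (m : ℝ) ^ 1 * |x| ^ m :=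
    summable_pow_mul_geometric_of_norm_lt_one 1 (by simpa using hx)
  have h2 := summable_geometric_of_lt_one (abs_nonneg x) hx
  refine Summable.of_norm_bounded (g := fun m : ℕ => C * ((m : ℝ) ^ 1 * |x| ^ m + |x| ^ m))
    ((h1.add h2).mul_left C) fun m => ?_
  rw [norm_mul, norm_mul, norm_pow, Complex.norm_real, Real.norm_eq_abs]
  have : ‖(m : ℂ) + 1‖ = m + 1 := by
    rw [show (m : ℂ) + 1 = ((m + 1 : ℕ) : ℂ) by push_cast; ring, Complex.norm_natCast]
    push_cast; ring
  rw [this]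
  have := ha (m + 1)
  calc ((m : ℝ) + 1) * ‖a (m + 1)‖ * |x| ^ m ≤ ((m : ℝ) + 1) * C * |x| ^ m := by gcongr
    _ = _ := by ring

theorem hasDerivAt_powSum {a : ℕ → ℂ} {C : ℝ} (ha : ∀ m, ‖a m‖ ≤ C) {x : ℝ} (hx : |x| < 1) :
    HasDerivAt (powSum a) (∑' m : ℕ, ((m : ℂ) + 1) * a (m + 1) * (x : ℂ) ^ m) x := by
  obtain ⟨r, hxr, hr⟩ := exists_between hx
  have hr0 : 0 < r := (abs_nonneg x).trans_lt hxr
  have hu : Summable fun m : ℕ => C * ((m : ℝ) * r ^ (m - 1)) := by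
    refine Summable.mul_left C ?_
    rw [← summable_nat_add_iff 1]
    have h1 : Summable fun m : ℕ => (m : ℝ) ^ 1 * r ^ m :=
      summable_pow_mul_geometric_of_norm_lt_one 1 (by simpa [abs_of_pos hr0] using hr)
    refine (h1.add (summable_geometric_of_lt_one hr0.le hr)).congr fun m => ?_
    push_cast [Nat.add_sub_cancel]
    ring
  -- The series is differentiated termwise on a complex disc of radius `r` with `|x| < r < 1`, then
  -- restricted to the real line.
  have key := hasDerivAt_tsum_of_isPreconnected (𝕜 := ℂ) (t := Metric.ball (0 : ℂ) r)
    (g := fun m y => a m * y ^ m) (g' := fun m y => a m * (m * y ^ (m - 1))) hu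
    Metric.isOpen_ball (convex_ball _ _).isPreconnected
    (fun m y _ => (hasDerivAt_pow m y).const_mul (a m))
    (fun m y hy => by
      have hy' : ‖y‖ ≤ r := by simpa using (mem_ball_zero_iff.1 hy).le
      rw [norm_mul, norm_mul, norm_pow, Complex.norm_natCast]
      gcongr
      · exact (norm_nonneg _).trans (ha m)
      · exact ha m)
    (y₀ := 0) (y := (x : ℂ)) (Metric.mem_ball_self hr0)
    (by simpa using summable_powSum ha (x := 0) (by simp))
    (by simpa using hxr)
  have := key.comp_ofReal
  refine this.congr_deriv ?_
  have hs : Summable fun m : ℕ => a m * ((m : ℂ) * (x : ℂ) ^ (m - 1)) := by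
    rw [← summable_nat_add_iff 1]
    refine (summable_succ_mul_powSum ha hx).congr fun m => ?_
    push_cast [Nat.add_sub_cancel]; ring
  rw [hs.tsum_eq_zero_add]
  simp only [Nat.cast_zero, zero_mul, mul_zero, zero_add]
  refine tsum_congr fun m => ?_
  push_cast [Nat.add_sub_cancel]; ring

/-- The Euler operator `x d/dx` multiplies the `m`-th coefficient by `m`. -/
theorem hasDerivAt_powSum_euler {a b : ℕ → ℂ} {C : ℝ} (ha : ∀ m, ‖a m‖ ≤ C)
    (hab : ∀ m : ℕ, (m : ℂ) * a m = b m) {x : ℝ} (hx0 : x ≠ 0) (hx : |x| < 1) :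
    HasDerivAt (powSum a) (powSum b x / x) x := by
  refine (hasDerivAt_powSum ha hx).congr_deriv ?_
  have hx0' : (x : ℂ) ≠ 0 := by exact_mod_cast hx0
  have hs := summable_succ_mul_powSum ha hx
  have hb : Summable fun m => b m * (x : ℂ) ^ m := by
    rw [← summable_nat_add_iff 1]
    refine (hs.mul_left (x : ℂ)).congr fun m => ?_
    rw [← hab]; push_cast; ring
  rw [eq_div_iff hx0', powSum, hb.tsum_eq_zero_add, ← tsum_mul_right, ← hab 0]
  simp only [Nat.cast_zero, zero_mul, zero_add]
  refine tsum_congr fun m => ?_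
  rw [← hab]; push_cast; ring

/-- The operator `(1 - x) d/dx` on coefficients. -/
theorem hasDerivAt_powSum_one_sub {a b : ℕ → ℂ} {C : ℝ} (ha : ∀ m, ‖a m‖ ≤ C)
    (hab : ∀ m : ℕ, ((m : ℂ) + 1) * a (m + 1) = ∑ k ∈ range (m + 1), b k) {x : ℝ}
    (hx : |x| < 1) :
    HasDerivAt (powSum a) (powSum b x / (1 - x)) x := by
  refine (hasDerivAt_powSum ha hx).congr_deriv ?_
  have hx0' : (1 - x : ℂ) ≠ 0 := by
    have : x ≠ 1 := by rintro rfl; simp at hx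
    rw [sub_ne_zero]; exact_mod_cast this.symm
  have hs := summable_succ_mul_powSum ha hx
  have h2 := hs.mul_left (x : ℂ)
  have h3 : Summable fun m : ℕ => (m : ℂ) * a m * (x : ℂ) ^ m := by
    rw [← summable_nat_add_iff 1]
    refine h2.congr fun m => ?_
    push_cast; ring
  have h4 : ∑' m : ℕ, (m : ℂ) * a m * (x : ℂ) ^ m
      = x * ∑' m : ℕ, ((m : ℂ) + 1) * a (m + 1) * (x : ℂ) ^ m := by
    rw [h3.tsum_eq_zero_add, ← tsum_mul_left]
    simp only [Nat.cast_zero, zero_mul, zero_add]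
    refine tsum_congr fun m => ?_
    push_cast; ring
  rw [eq_div_iff hx0', mul_comm, sub_mul, one_mul, ← h4, ← hs.tsum_sub h3, powSum]
  refine tsum_congr fun m => ?_
  rw [hab]
  cases m with
  | zero => simp
  | succ m =>
    rw [sum_range_succ]
    push_cast
    rw [hab]
    ring

theorem continuousOn_powSum {a : ℕ → ℂ} (ha : Summable fun m => ‖a m‖) :
    ContinuousOn (powSum a) (Set.Icc 0 1) := by
  refine continuousOn_tsum (fun m => by fun_prop) ha fun m x hx => ?_
  rw [norm_mul, norm_pow, Complex.norm_real, Real.norm_of_nonneg hx.1]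
  exact mul_le_of_le_one_right (norm_nonneg _) (pow_le_one₀ hx.1 hx.2)

theorem norm_powSum_sub_le {a : ℕ → ℂ} {C : ℝ} (ha : ∀ m, ‖a m‖ ≤ C) {x : ℝ} (hx0 : 0 ≤ x)
    (hx : x ≤ 1 / 2) : ‖powSum a x - a 0‖ ≤ 2 * C * x := by
  have hx1 : |x| < 1 := by rw [abs_of_nonneg hx0]; linarith
  have hC : 0 ≤ C := (norm_nonneg _).trans (ha 0)
  rw [powSum, (summable_powSum ha hx1).tsum_eq_zero_add]
  simp only [pow_zero, mul_one, add_sub_cancel_left]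
  have hg : HasSum (fun m : ℕ => C * x * x ^ m) (C * x * (1 - x)⁻¹) :=
    (hasSum_geometric_of_lt_one hx0 (by linarith)).mul_left _
  refine (tsum_of_norm_bounded hg fun m => ?_).trans ?_
  · rw [norm_mul, norm_pow, Complex.norm_real, Real.norm_of_nonneg hx0, pow_succ']
    have := mul_le_mul_of_nonneg_right (ha (m + 1)) (by positivity : 0 ≤ x * x ^ m)
    linarith
  · have h : (1 - x)⁻¹ ≤ 2 := by
      rw [inv_le_comm₀ (by linarith) (by norm_num)]; linarith
    calc C * x * (1 - x)⁻¹ ≤ C * x * 2 := by gcongr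
      _ = _ := by ring

/-! ### Multiple zeta values as iterated sums -/

/-- Strictly decreasing tuples of positive integers all of whose entries are `< N`. -/
abbrev BoundedTuple (k N : ℕ) : Type :=
  {n : Fin k → ℕ // StrictAnti n ∧ (∀ j, 0 < n j) ∧ ∀ j, n j < N}

theorem strictAnti_cons_iff {k : ℕ} {m : ℕ} {n : Fin k → ℕ} :
    StrictAnti (Fin.cons m n : Fin (k + 1) → ℕ) ↔ StrictAnti n ∧ ∀ j, n j < m := by
  constructor
  · intro h
    exact ⟨fun i j hij => by simpa using h (Fin.succ_lt_succ_iff.2 hij),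
      fun j => by simpa using h (Fin.succ_pos j)⟩
  · rintro ⟨h1, h2⟩ i j hij
    induction j using Fin.cases with
    | zero => exact absurd hij (Fin.not_lt_zero i)
    | succ j =>
      induction i using Fin.cases with
      | zero => simpa using h2 j
      | succ i => simpa using h1 (Fin.succ_lt_succ_iff.1 hij)

/-- Splitting off the largest entry of a strictly decreasing tuple. -/
def tupleConsEquiv (k : ℕ) (I : Set ℕ) :
    (Σ m : {m : ℕ // 0 < m ∧ m ∈ I}, BoundedTuple k m) ≃
      {n : Fin (k + 1) → ℕ // StrictAnti n ∧ (∀ j, 0 < n j) ∧ n 0 ∈ I} where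
  toFun p := ⟨Fin.cons p.1.1 p.2.1, strictAnti_cons_iff.2 ⟨p.2.2.1, p.2.2.2.2⟩,
    fun j => by
      induction j using Fin.cases with
      | zero => simpa using p.1.2.1
      | succ j => simpa using p.2.2.2.1 j,
    by simpa using p.1.2.2⟩
  invFun n := ⟨⟨n.1 0, n.2.2.1 0, n.2.2.2⟩, ⟨Fin.tail n.1,
    (strictAnti_cons_iff.1 (by rw [Fin.cons_self_tail]; exact n.2.1)).1,
    fun j => n.2.2.1 j.succ, fun j => n.2.1 (Fin.succ_pos j)⟩⟩
  left_inv p := by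
    obtain ⟨⟨m, hm⟩, ⟨n, hn⟩⟩ := p
    rfl
  right_inv n := by
    obtain ⟨n, hn⟩ := n
    simp

/-- Summation over the largest entry last. All terms are nonnegative, so summability of the fibre
sums already gives summability over the tuples. Taking `I` to be `Set.Iio N` or `Set.univ` covers
truncated and full sums alike. -/
theorem hasSum_tuple_cons {k : ℕ} {I : Set ℕ} {w G : ℕ → ℝ} {F : (Fin k → ℕ) → ℝ} {a : ℝ}
    (hw : ∀ m, 0 ≤ w m) (hF0 : ∀ n, 0 ≤ F n)
    (hF : ∀ m, HasSum (fun n : BoundedTuple k m => F n.1) (G m))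
    (hs : HasSum (Set.indicator {m | 0 < m ∧ m ∈ I} fun m => w m * G m) a) :
    HasSum (fun n : {n : Fin (k + 1) → ℕ // StrictAnti n ∧ (∀ j, 0 < n j) ∧ n 0 ∈ I} =>
      w (n.1 0) * F (Fin.tail n.1)) a := by
  rw [← (tupleConsEquiv k I).hasSum_iff]
  have hs' : HasSum (fun m : {m : ℕ // 0 < m ∧ m ∈ I} => w m * G m) a :=
    (hasSum_subtype_iff_indicator (s := {m | 0 < m ∧ m ∈ I})).2 hs
  have hfib : ∀ m : {m : ℕ // 0 < m ∧ m ∈ I},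
      HasSum (fun n : BoundedTuple k m => w m * F n.1) (w m * G m) :=
    fun m => (hF m).mul_left _
  have hsum : Summable fun p : Σ m : {m : ℕ // 0 < m ∧ m ∈ I}, BoundedTuple k m =>
      w p.1 * F p.2.1 := by
    rw [summable_sigma_of_nonneg fun p => mul_nonneg (hw _) (hF0 _)]
    exact ⟨fun m => (hfib m).summable, by simpa only [(hfib _).tsum_eq] using hs'.summable⟩
  refine (hs'.sigma_of_hasSum hfib hsum).congr_fun fun p => ?_
  simp [tupleConsEquiv]

/-- The truncated multiple harmonic sum over `N > n₁ > ⋯ > n_k > 0`. -/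
def truncZeta : List ℕ → ℕ → ℝ
  | [], _ => 1
  | s :: l, N => ∑ m ∈ range N, ((m : ℝ) ^ s)⁻¹ * truncZeta l m

theorem truncZeta_nonneg (l : List ℕ) (N : ℕ) : 0 ≤ truncZeta l N := by
  induction l generalizing N with
  | nil => simp [truncZeta]
  | cons s l ih =>
    exact sum_nonneg fun m _ => mul_nonneg (by positivity) (ih m)

theorem hasSum_truncZeta (l : List ℕ) (hl : ∀ s ∈ l, 0 < s) (N : ℕ) :
    HasSum (fun n : BoundedTuple l.length N => ∏ j, ((n.1 j : ℝ) ^ l.get j)⁻¹)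
      (truncZeta l N) := by
  induction l generalizing N with
  | nil =>
    have : Unique (BoundedTuple ([] : List ℕ).length N) :=
      { default := ⟨Fin.elim0, fun i => i.elim0, fun i => i.elim0, fun i => i.elim0⟩
        uniq := fun n => Subtype.ext (funext fun i => i.elim0) }
    simp [truncZeta]
  | cons s l ih =>
    have hs : 0 < s := hl s (by simp)
    have h := hasSum_tuple_cons (I := Set.Iio N) (w := fun m => ((m : ℝ) ^ s)⁻¹)
      (F := fun n : Fin l.length → ℕ => ∏ j, ((n j : ℝ) ^ l.get j)⁻¹)
      (G := truncZeta l) (a := truncZeta (s :: l) N) (fun m => by positivity)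
      (fun n => prod_nonneg fun _ _ => by positivity)
      (fun m => ih (fun t ht => hl t (by simp [ht])) m) (by
        have h1 : HasSum (fun m => Set.indicator (↑(range N))
            (fun m : ℕ => ((m : ℝ) ^ s)⁻¹ * truncZeta l m) m) (truncZeta (s :: l) N) := by
          rw [truncZeta, ← hasSum_subtype_iff_indicator]
          exact Finset.hasSum _ _
        refine h1.congr_fun fun m => ?_
        -- `range N` contains 0, which no tuple does; since `s > 0`, the weight there is `0⁻¹ = 0`.
        rcases Nat.eq_zero_or_pos m with rfl | hm
        · simp [Set.indicator, hs.ne']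
        · simp [Set.indicator, hm])
    let e : BoundedTuple (s :: l).length N ≃ {n : Fin (l.length + 1) → ℕ //
        StrictAnti n ∧ (∀ j, 0 < n j) ∧ n 0 ∈ Set.Iio N} :=
      Equiv.subtypeEquivRight fun n => by
        refine and_congr_right fun h1 => and_congr_right fun _ => ⟨fun h => h 0, fun h j => ?_⟩
        exact (h1.antitone (Fin.zero_le j)).trans_lt h
    rw [← e.hasSum_iff] at h
    refine h.congr_fun fun n => ?_
    exact Fin.prod_univ_succ (n := l.length)
      fun j : Fin (l.length + 1) => ((n.1 j : ℝ) ^ (s :: l).get j)⁻¹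

theorem hasSum_multiZeta_cons {s : ℕ} {l : List ℕ} (hs : 0 < s) (hl : ∀ t ∈ l, 0 < t) {x a : ℝ}
    (hx : 0 ≤ x) (h : HasSum (fun m : ℕ => x ^ m * ((m : ℝ) ^ s)⁻¹ * truncZeta l m) a) :
    multiZeta x (s :: l) = a := by
  have h := hasSum_tuple_cons (I := Set.univ) (w := fun m => x ^ m * ((m : ℝ) ^ s)⁻¹)
      (F := fun n : Fin l.length → ℕ => ∏ j, ((n j : ℝ) ^ l.get j)⁻¹)
      (G := truncZeta l) (a := a) (fun m => by positivity)
      (fun n => prod_nonneg fun _ _ => by positivity)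
      (fun m => hasSum_truncZeta l hl m) (by
        refine h.congr_fun fun m => ?_
        rcases Nat.eq_zero_or_pos m with rfl | hm
        · simp [Set.indicator, hs.ne']
        · simp [Set.indicator, hm])
  let e : {n : Fin (s :: l).length → ℕ // StrictAnti n ∧ ∀ j, 0 < n j} ≃
      {n : Fin (l.length + 1) → ℕ // StrictAnti n ∧ (∀ j, 0 < n j) ∧ n 0 ∈ Set.univ} :=
    Equiv.subtypeEquivRight fun n => by simp
  rw [← e.hasSum_iff] at h
  refine (h.congr_fun fun n => ?_).tsum_eq
  rw [Function.comp_apply, dif_pos (by simp), mul_assoc]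
  exact congrArg _ (Fin.prod_univ_succ (n := l.length)
    fun j : Fin (l.length + 1) => ((n.1 j : ℝ) ^ (s :: l).get j)⁻¹)

theorem strPow_succ (s : List ℕ) (n : ℕ) : strPow s (n + 1) = s ++ strPow s n := by
  simp [strPow, List.replicate_succ]

theorem pos_of_mem_strPow {s : List ℕ} (hs : ∀ t ∈ s, 0 < t) (n : ℕ) :
    ∀ t ∈ strPow s n, 0 < t := by
  intro t ht
  rw [strPow, List.mem_flatten] at ht
  obtain ⟨l, hl, htl⟩ := ht
  rw [List.eq_of_mem_replicate hl] at htl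
  exact hs t htl

/-! ### Coefficients of `ζ_x(3, {1, 3}^n)` and their decay in `n` -/

/-- The coefficient of `x ^ m` in `ζ_x(3, {1, 3}^n)`. -/
def zetaCoeff (n m : ℕ) : ℝ := ((m : ℝ) ^ 3)⁻¹ * truncZeta (strPow [1, 3] n) m

theorem zetaCoeff_nonneg (n m : ℕ) : 0 ≤ zetaCoeff n m :=
  mul_nonneg (by positivity) (truncZeta_nonneg _ _)

@[simp]
theorem zetaCoeff_zero_right (n : ℕ) : zetaCoeff n 0 = 0 := by simp [zetaCoeff]

theorem truncZeta_strPow_succ (n m : ℕ) : truncZeta (strPow [1, 3] (n + 1)) m =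
    ∑ l ∈ range m, (l : ℝ)⁻¹ * ∑ k ∈ range l, zetaCoeff n k := by
  rw [strPow_succ]
  simp [truncZeta, zetaCoeff]

theorem sum_range_inv_cube_le (N : ℕ) : ∑ k ∈ range N, ((k : ℝ) ^ 3)⁻¹ ≤ 2 := by
  have h : ∀ N : ℕ, ∑ k ∈ range (N + 1), ((k : ℝ) ^ 3)⁻¹ ≤ 2 - 2 / (N + 1) := by
    intro N
    induction N with
    | zero => simp
    | succ N ih =>
      rw [sum_range_succ]
      have : (((N + 1 : ℕ) : ℝ) ^ 3)⁻¹ ≤ 2 / (N + 1) - 2 / (N + 1 + 1) := by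
        push_cast
        rw [div_sub_div _ _ (by positivity) (by positivity), inv_eq_one_div,
          div_le_div_iff₀ (by positivity) (by positivity)]
        have hN : (0 : ℝ) ≤ N := by positivity
        nlinarith [mul_nonneg hN hN, mul_nonneg (mul_nonneg hN hN) hN]
      push_cast at *
      linarith
  cases N with
  | zero => simp
  | succ N =>
    refine (h N).trans ?_
    have : (0 : ℝ) ≤ 2 / (N + 1) := by positivity
    linarith

theorem sum_range_sub_two_div_cube_le (N : ℕ) :
    ∑ m ∈ range N, ((m : ℝ) ^ 3)⁻¹ * ((m - 2 : ℕ) : ℝ) ≤ 1 / 3 := by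
  have h : ∀ N : ℕ, ∑ m ∈ range (N + 3), ((m : ℝ) ^ 3)⁻¹ * ((m - 2 : ℕ) : ℝ)
      ≤ 1 / 3 - 1 / (N + 3) := by
    intro N
    induction N with
    | zero => simp [sum_range_succ]
    | succ N ih =>
      rw [show N + 1 + 3 = N + 3 + 1 by ring, sum_range_succ, show N + 3 - 2 = N + 1 by omega]
      -- Telescoping through `(m - 2) / m³ ≤ 1/m - 1/(m + 1)`; the terms with `m < 3` vanish by
      -- truncated subtraction.
      have : (((N + 3 : ℕ) : ℝ) ^ 3)⁻¹ * ((N + 1 : ℕ) : ℝ) ≤ 1 / (N + 3) - 1 / (N + 1 + 3) := by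
        push_cast
        rw [div_sub_div _ _ (by positivity) (by positivity), inv_mul_eq_div,
          div_le_div_iff₀ (by positivity) (by positivity)]
        have hN : (0 : ℝ) ≤ N := by positivity
        nlinarith [mul_nonneg hN hN, mul_nonneg (mul_nonneg hN hN) hN]
      push_cast at *
      linarith
  have h2 : ∑ m ∈ range N, ((m : ℝ) ^ 3)⁻¹ * ((m - 2 : ℕ) : ℝ) ≤
      ∑ m ∈ range (N + 3), ((m : ℝ) ^ 3)⁻¹ * ((m - 2 : ℕ) : ℝ) :=
    sum_le_sum_of_subset_of_nonneg (range_subset_range.2 (by omega)) fun _ _ _ => by positivity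
  refine (h2.trans (h N)).trans ?_
  have : (0 : ℝ) ≤ 1 / (N + 3) := by positivity
  linarith

/-- The outer index `l` contributes nothing for `l < 2`, because `zetaCoeff n 0 = 0`, and at most `B
/ 2` otherwise. At most `m - 2` indices are left. -/
theorem truncZeta_strPow_succ_le {n : ℕ} {B : ℝ} (hB : ∀ N, ∑ k ∈ range N, zetaCoeff n k ≤ B)
    (m : ℕ) : truncZeta (strPow [1, 3] (n + 1)) m ≤ B / 2 * ((m - 2 : ℕ) : ℝ) := by
  have hB0 : 0 ≤ B := by simpa using hB 0
  rw [truncZeta_strPow_succ]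
  induction m with
  | zero => simp
  | succ m ih =>
    rw [sum_range_succ]
    rcases Nat.lt_or_ge m 2 with hm | hm
    · interval_cases m <;> simp
    · have h1 : (m : ℝ)⁻¹ * ∑ k ∈ range m, zetaCoeff n k ≤ 2⁻¹ * B := by
        have h2 : (2 : ℝ) ≤ m := by exact_mod_cast hm
        exact mul_le_mul (inv_anti₀ two_pos h2) (hB m)
          (sum_nonneg fun k _ => zetaCoeff_nonneg n k) (by norm_num)
      rw [show m + 1 - 2 = (m - 2) + 1 by omega]
      push_cast
      linarith

/-- Each block `1, 3` costs a factor `1/2 * 1/3`. The rate `1/6` matters: it must beat the factor `4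
^ n` of the generating function. -/
theorem sum_zetaCoeff_le (n N : ℕ) : ∑ k ∈ range N, zetaCoeff n k ≤ 2 * (1 / 6) ^ n := by
  induction n generalizing N with
  | zero => simpa [zetaCoeff, strPow, truncZeta] using sum_range_inv_cube_le N
  | succ n ih =>
    have hle : ∀ m, zetaCoeff (n + 1) m ≤
        2 * (1 / 6) ^ n / 2 * (((m : ℝ) ^ 3)⁻¹ * ((m - 2 : ℕ) : ℝ)) := fun m => by
      rw [zetaCoeff, mul_left_comm]
      exact mul_le_mul_of_nonneg_left (truncZeta_strPow_succ_le ih m) (by positivity)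
    calc ∑ k ∈ range N, zetaCoeff (n + 1) k
        ≤ ∑ m ∈ range N, 2 * (1 / 6) ^ n / 2 * (((m : ℝ) ^ 3)⁻¹ * ((m - 2 : ℕ) : ℝ)) :=
          sum_le_sum fun m _ => hle m
      _ = 2 * (1 / 6) ^ n / 2 * ∑ m ∈ range N, ((m : ℝ) ^ 3)⁻¹ * ((m - 2 : ℕ) : ℝ) := by
          rw [mul_sum]
      _ ≤ 2 * (1 / 6) ^ n / 2 * (1 / 3) := by
          gcongr
          exact sum_range_sub_two_div_cube_le N
      _ = 2 * (1 / 6) ^ (n + 1) := by ring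

theorem zetaCoeff_le (n m : ℕ) : zetaCoeff n m ≤ 6 * (1 / 6) ^ n * ((m : ℝ) ^ 2)⁻¹ := by
  rcases Nat.eq_zero_or_pos m with rfl | hm
  · simp
  have hm1 : (1 : ℝ) ≤ m := by exact_mod_cast hm
  have key : truncZeta (strPow [1, 3] n) m ≤ 6 * (1 / 6) ^ n * m := by
    cases n with
    | zero => simp [strPow, truncZeta]; linarith
    | succ n =>
      refine (truncZeta_strPow_succ_le (sum_zetaCoeff_le n) m).trans ?_
      have : ((m - 2 : ℕ) : ℝ) ≤ m := by exact_mod_cast Nat.sub_le m 2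
      calc 2 * (1 / 6 : ℝ) ^ n / 2 * ((m - 2 : ℕ) : ℝ) ≤ 2 * (1 / 6) ^ n / 2 * m := by gcongr
        _ = _ := by ring
  calc zetaCoeff n m ≤ ((m : ℝ) ^ 3)⁻¹ * (6 * (1 / 6) ^ n * m) := by
        rw [zetaCoeff]; gcongr
    _ = _ := by field_simp

theorem summable_inv_sq : Summable fun m : ℕ => ((m : ℝ) ^ 2)⁻¹ :=
  Real.summable_nat_pow_inv.2 one_lt_two

theorem multiZeta_three_eq_tsum {x : ℝ} (hx0 : 0 ≤ x) (hx1 : x ≤ 1) (n : ℕ) :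
    HasSum (fun m => zetaCoeff n m * x ^ m) (multiZeta x (3 :: strPow [1, 3] n)) := by
  have hs : Summable fun m => zetaCoeff n m * x ^ m := by
    refine Summable.of_nonneg_of_le (fun m => mul_nonneg (zetaCoeff_nonneg n m) (by positivity))
      (fun m => ?_) (summable_inv_sq.mul_left (6 * (1 / 6) ^ n))
    exact (mul_le_of_le_one_right (zetaCoeff_nonneg n m) (pow_le_one₀ hx0 hx1)).trans
      (zetaCoeff_le n m)
  rw [hasSum_multiZeta_cons (a := ∑' m, zetaCoeff n m * x ^ m) (by norm_num)
    (pos_of_mem_strPow (by simp) n) hx0 (hs.hasSum.congr_fun fun m => by rw [zetaCoeff]; ring)]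
  exact hs.hasSum

/-! ### The generating function and its differential equation on coefficients -/

/-- The factor `(-1) ^ n z ^ (4 n + 2) 4 ^ n`. -/
def genFactor (z : ℂ) (n : ℕ) : ℂ := (-1) ^ n * z ^ (4 * n + 2) * 4 ^ n

theorem genFactor_succ (z : ℂ) (n : ℕ) : genFactor z (n + 1) = -4 * z ^ 4 * genFactor z n := by
  rw [genFactor, genFactor]; ring

theorem norm_genFactor_mul_le {z : ℂ} (hz : ‖z‖ < 1) (n m : ℕ) :
    ‖genFactor z n * zetaCoeff n m‖ ≤ 6 * (2 / 3) ^ n * ((m : ℝ) ^ 2)⁻¹ := by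
  have h1 : ‖genFactor z n‖ ≤ 4 ^ n := by
    rw [genFactor]
    simp only [norm_mul, norm_pow, norm_neg, norm_one, one_pow, one_mul, RCLike.norm_ofNat]
    exact mul_le_of_le_one_left (by positivity) (pow_le_one₀ (norm_nonneg _) hz.le)
  rw [norm_mul, Complex.norm_real, Real.norm_of_nonneg (zetaCoeff_nonneg n m)]
  calc ‖genFactor z n‖ * zetaCoeff n m ≤ 4 ^ n * (6 * (1 / 6) ^ n * ((m : ℝ) ^ 2)⁻¹) :=
        mul_le_mul h1 (zetaCoeff_le n m) (zetaCoeff_nonneg n m) (by positivity)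
    _ = 6 * (4 * (1 / 6)) ^ n * ((m : ℝ) ^ 2)⁻¹ := by rw [mul_pow]; ring
    _ = _ := by norm_num

theorem summable_genFactor_mul {z : ℂ} (hz : ‖z‖ < 1) (m : ℕ) :
    Summable fun n => genFactor z n * (zetaCoeff n m : ℂ) := by
  refine Summable.of_norm_bounded ?_ fun n => norm_genFactor_mul_le hz n m
  exact ((summable_geometric_of_lt_one (by norm_num) (by norm_num)).mul_left 6).mul_right _

/-- The coefficient of `x ^ m` in the generating function. -/
def genCoeff (z : ℂ) (m : ℕ) : ℂ := ∑' n, genFactor z n * (zetaCoeff n m : ℂ)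

theorem norm_genCoeff_le {z : ℂ} (hz : ‖z‖ < 1) (m : ℕ) :
    ‖genCoeff z m‖ ≤ 18 * ((m : ℝ) ^ 2)⁻¹ := by
  have h : HasSum (fun n : ℕ => 6 * (2 / 3 : ℝ) ^ n * ((m : ℝ) ^ 2)⁻¹)
      (6 * (1 - 2 / 3)⁻¹ * ((m : ℝ) ^ 2)⁻¹) :=
    ((hasSum_geometric_of_lt_one (by norm_num) (by norm_num)).mul_left 6).mul_right _
  refine (tsum_of_norm_bounded h fun n => norm_genFactor_mul_le hz n m).trans (le_of_eq ?_)
  norm_num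

@[simp]
theorem genCoeff_zero_right (z : ℂ) : genCoeff z 0 = 0 := by simp [genCoeff]

/-- Interchange of the sums over `n` and `m`, dominated by `6 (2/3)^n / m²` uniformly up to `x = 1`.
-/
theorem hasSum_genTerm {x : ℝ} {z : ℂ} (hx0 : 0 ≤ x) (hx1 : x ≤ 1) (hz : ‖z‖ < 1) :
    HasSum (genTerm x z) (powSum (genCoeff z) x) := by
  have hs : Summable fun p : ℕ × ℕ => genFactor z p.1 * (zetaCoeff p.1 p.2 : ℂ) * (x : ℂ) ^ p.2 := by
    refine Summable.of_norm_bounded (g := fun p : ℕ × ℕ => 6 * (2 / 3 : ℝ) ^ p.1 * ((p.2 : ℝ) ^ 2)⁻¹)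
      (Summable.mul_of_nonneg (f := fun n : ℕ => 6 * (2 / 3 : ℝ) ^ n)
        (g := fun m : ℕ => ((m : ℝ) ^ 2)⁻¹)
        ((summable_geometric_of_lt_one (by norm_num) (by norm_num)).mul_left 6)
        summable_inv_sq (fun n => by positivity) (fun m => by positivity)) fun p => ?_
    rw [norm_mul, norm_pow, Complex.norm_real, Real.norm_of_nonneg hx0]
    exact (mul_le_of_le_one_right (norm_nonneg _) (pow_le_one₀ hx0 hx1)).trans
      (norm_genFactor_mul_le hz _ _)
  have h1 : HasSum (genTerm x z) (∑' p : ℕ × ℕ,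
      genFactor z p.1 * (zetaCoeff p.1 p.2 : ℂ) * (x : ℂ) ^ p.2) := by
    refine hs.hasSum.prod_fiberwise fun n => ?_
    have h := (Complex.hasSum_ofReal.2 (multiZeta_three_eq_tsum hx0 hx1 n)).mul_left
      (genFactor z n)
    refine h.congr_fun fun m => ?_
    push_cast; ring
  have h2 : HasSum (fun m => genCoeff z m * (x : ℂ) ^ m) (∑' p : ℕ × ℕ,
      genFactor z p.1 * (zetaCoeff p.1 p.2 : ℂ) * (x : ℂ) ^ p.2) := by
    have h3 : HasSum (fun p : ℕ × ℕ => genFactor z p.2 * (zetaCoeff p.2 p.1 : ℂ) * (x : ℂ) ^ p.1)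
        (∑' p : ℕ × ℕ, genFactor z p.1 * (zetaCoeff p.1 p.2 : ℂ) * (x : ℂ) ^ p.2) :=
      (Equiv.prodComm ℕ ℕ).hasSum_iff (f := fun p : ℕ × ℕ =>
        genFactor z p.1 * (zetaCoeff p.1 p.2 : ℂ) * (x : ℂ) ^ p.2) |>.2 hs.hasSum
    exact h3.prod_fiberwise fun m =>
      (summable_genFactor_mul hz m).hasSum.mul_right ((x : ℂ) ^ m)
  rw [powSum, h2.tsum_eq]
  exact h1

/-- The coefficients of `(1 - x) d/dx (x d/dx)²` of the generating function, divided by `z²`. -/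
def genOmega (z : ℂ) (l : ℕ) : ℂ :=
  if l = 0 then 1 else -4 * z ^ 2 * (l : ℂ)⁻¹ * ∑ k ∈ range l, genCoeff z k

theorem succ_mul_genOmega_succ (z : ℂ) (m : ℕ) :
    ((m : ℂ) + 1) * genOmega z (m + 1) = ∑ k ∈ range (m + 1), -4 * z ^ 2 * genCoeff z k := by
  have : (m : ℂ) + 1 ≠ 0 := by exact_mod_cast m.succ_ne_zero
  rw [genOmega, if_neg m.succ_ne_zero, ← mul_sum]
  push_cast
  field_simp

/-- In the form required by `hasDerivAt_powSum_one_sub`, this says `(1 - x) S₂' = z² Ω`. The cube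
clears the leading argument 3. The term `n = 0` yields the constant coefficient of `Ω`, and the
terms `n + 1` lose one block `1, 3` at the price of `-4 z⁴`. -/
theorem cube_mul_genCoeff {z : ℂ} (hz : ‖z‖ < 1) (m : ℕ) :
    ((m : ℂ) + 1) * (((m + 1 : ℕ) : ℂ) ^ 2 * genCoeff z (m + 1)) =
      ∑ l ∈ range (m + 1), z ^ 2 * genOmega z l := by
  have hm : (m : ℂ) + 1 ≠ 0 := by exact_mod_cast m.succ_ne_zero
  have h1 : ∀ n, (((m : ℂ) + 1) ^ 3) * (zetaCoeff n (m + 1) : ℂ) =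
      (truncZeta (strPow [1, 3] n) (m + 1) : ℂ) := fun n => by
    rw [zetaCoeff]; push_cast; field_simp
  have hs := (summable_genFactor_mul hz (m + 1)).mul_left (((m : ℂ) + 1) ^ 3)
  have h2 : ((m : ℂ) + 1) * (((m + 1 : ℕ) : ℂ) ^ 2 * genCoeff z (m + 1)) =
      ∑' n, ((m : ℂ) + 1) ^ 3 * (genFactor z n * (zetaCoeff n (m + 1) : ℂ)) := by
    rw [tsum_mul_left, genCoeff]; push_cast; ring
  have h3 : ∀ n, ((m : ℂ) + 1) ^ 3 * (genFactor z (n + 1) * (zetaCoeff (n + 1) (m + 1) : ℂ)) =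
      ∑ l ∈ range (m + 1), -4 * z ^ 4 * (l : ℂ)⁻¹ *
        ∑ k ∈ range l, genFactor z n * (zetaCoeff n k : ℂ) := fun n => by
    rw [mul_left_comm, h1, truncZeta_strPow_succ, genFactor_succ]
    push_cast
    simp_rw [mul_sum]
    refine sum_congr rfl fun l _ => sum_congr rfl fun k _ => ?_
    ring
  have h4 : ∑' n, ∑ l ∈ range (m + 1), -4 * z ^ 4 * (l : ℂ)⁻¹ *
        ∑ k ∈ range l, genFactor z n * (zetaCoeff n k : ℂ) =
      ∑ l ∈ range (m + 1), -4 * z ^ 4 * (l : ℂ)⁻¹ * ∑ k ∈ range l, genCoeff z k := by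
    have hk : ∀ l : ℕ, HasSum (fun n => ∑ k ∈ range l, genFactor z n * (zetaCoeff n k : ℂ))
        (∑ k ∈ range l, genCoeff z k) := fun l =>
      hasSum_sum fun k _ => (summable_genFactor_mul hz k).hasSum
    exact (hasSum_sum fun l _ => (hk l).mul_left _).tsum_eq
  rw [h2, hs.tsum_eq_zero_add]
  simp_rw [h3]
  rw [h4, mul_left_comm, h1, sum_range_succ', sum_range_succ']
  have h0 : truncZeta (strPow [1, 3] 0) (m + 1) = 1 := by simp [strPow, truncZeta]
  have h5 : genFactor z 0 = z ^ 2 := by simp [genFactor]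
  rw [h0, h5, add_comm]
  simp only [genOmega, if_neg (Nat.succ_ne_zero _), if_true, range_zero, sum_empty, mul_zero,
    add_zero, Complex.ofReal_one]
  congr 1
  refine sum_congr rfl fun l _ => ?_
  ring

/-! ### The hypergeometric series and Euler's sine product -/

/-- The partial products of Euler's product for `sin (π z) / (π z)`. -/
def sinProd (z : ℂ) (n : ℕ) : ℂ := ∏ j ∈ range n, (1 - z ^ 2 / ((j : ℂ) + 1) ^ 2)

/-- The coefficients of `F(z, -z; 1; x)`. -/
def hypCoeff (z : ℂ) : ℕ → ℂ
  | 0 => 1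
  | n + 1 => -z ^ 2 / ((n : ℂ) + 1) ^ 2 * sinProd z n

/-- The coefficients of `x F(1 + z, 1 - z; 2; x)`. -/
def hypCoeff₂ (z : ℂ) : ℕ → ℂ
  | 0 => 0
  | n + 1 => sinProd z n / ((n : ℂ) + 1)

theorem natCast_succ_ne_zero (n : ℕ) : (n : ℂ) + 1 ≠ 0 := by exact_mod_cast n.succ_ne_zero

theorem norm_natCast_succ (n : ℕ) : ‖(n : ℂ) + 1‖ = n + 1 := by
  rw [show (n : ℂ) + 1 = ((n + 1 : ℕ) : ℂ) by push_cast; ring, Complex.norm_natCast]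
  push_cast; ring

theorem sinProd_succ (z : ℂ) (n : ℕ) :
    sinProd z (n + 1) = sinProd z n * (1 - z ^ 2 / ((n : ℂ) + 1) ^ 2) := by
  rw [sinProd, prod_range_succ, sinProd]

/-- `hypCoeff z (n + 1)` is the increment `sinProd z (n + 1) - sinProd z n`. Hence `Y₁(1, z)` is
Euler's infinite product, and the two series are linked by `(1 - x) d/dx`. -/
theorem sum_hypCoeff (z : ℂ) (n : ℕ) : ∑ k ∈ range (n + 1), hypCoeff z k = sinProd z n := by
  induction n with
  | zero => simp [hypCoeff, sinProd]
  | succ n ih => rw [sum_range_succ, ih, sinProd_succ, hypCoeff]; ring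

theorem norm_sinProd_le {z : ℂ} (hz : ‖z‖ < 1) (n : ℕ) : ‖sinProd z n‖ ≤ 4 := by
  -- With `k = n + 2`, the majorant grows from `n` to `n + 1` by `k² / (k² - 1)`, which exceeds the
  -- factor bound `1 + 1/k²`.
  have h : ∀ n : ℕ, ‖sinProd z (n + 1)‖ ≤ 4 * (n + 1) / (n + 2) := by
    have hf : ∀ n : ℕ, ‖1 - z ^ 2 / ((n : ℂ) + 1) ^ 2‖ ≤ 1 + 1 / ((n : ℝ) + 1) ^ 2 := by
      intro n
      refine (norm_sub_le _ _).trans ?_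
      rw [norm_one, norm_div, norm_pow, norm_pow, norm_natCast_succ]
      gcongr
      exact pow_le_one₀ (norm_nonneg _) hz.le
    intro n
    induction n with
    | zero =>
      have := hf 0
      rw [sinProd_succ]
      simp only [sinProd, range_zero, prod_empty, one_mul]
      norm_num at this ⊢
      exact this
    | succ n ih =>
      rw [sinProd_succ, norm_mul]
      refine (mul_le_mul ih (hf (n + 1)) (norm_nonneg _) (by positivity)).trans ?_
      push_cast
      rw [← sub_nonneg]
      have : 4 * ((n : ℝ) + 1 + 1) / (n + 1 + 2) - 4 * (n + 1) / (n + 2) *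
          (1 + 1 / ((n : ℝ) + 1 + 1) ^ 2) = 4 / ((n + 3) * (n + 2) ^ 3) := by
        field_simp
        ring
      rw [this]
      positivity
  cases n with
  | zero => simp [sinProd]
  | succ n =>
    refine (h n).trans ?_
    rw [div_le_iff₀ (by positivity)]
    linarith

theorem norm_hypCoeff_le {z : ℂ} (hz : ‖z‖ < 1) (n : ℕ) :
    ‖hypCoeff z (n + 1)‖ ≤ 4 / ((n : ℝ) + 1) ^ 2 := by
  rw [hypCoeff, norm_mul, norm_div, norm_neg, norm_pow, norm_pow, norm_natCast_succ]
  have h1 : ‖z‖ ^ 2 ≤ 1 := pow_le_one₀ (norm_nonneg _) hz.le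
  calc ‖z‖ ^ 2 / ((n : ℝ) + 1) ^ 2 * ‖sinProd z n‖ ≤ 1 / ((n : ℝ) + 1) ^ 2 * 4 := by
        gcongr; exact norm_sinProd_le hz n
    _ = _ := by ring

theorem summable_norm_hypCoeff {z : ℂ} (hz : ‖z‖ < 1) : Summable fun n => ‖hypCoeff z n‖ := by
  rw [← summable_nat_add_iff 1]
  refine Summable.of_nonneg_of_le (fun _ => norm_nonneg _) (norm_hypCoeff_le hz) ?_
  have := ((summable_nat_add_iff 1).2 summable_inv_sq).mul_left 4
  refine this.congr fun n => ?_
  push_cast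
  rw [div_eq_mul_inv]

theorem norm_hypCoeff_le_four {z : ℂ} (hz : ‖z‖ < 1) (n : ℕ) : ‖hypCoeff z n‖ ≤ 4 := by
  cases n with
  | zero => simp [hypCoeff]
  | succ n =>
    refine (norm_hypCoeff_le hz n).trans (div_le_self (by norm_num) ?_)
    exact one_le_pow₀ (by linarith [Nat.cast_nonneg (α := ℝ) n])

theorem norm_hypCoeff₂_le {z : ℂ} (hz : ‖z‖ < 1) (n : ℕ) : ‖hypCoeff₂ z n‖ ≤ 4 := by
  cases n with
  | zero => simp [hypCoeff₂]
  | succ n =>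
    rw [hypCoeff₂, norm_div, norm_natCast_succ]
    refine (div_le_self (norm_nonneg _) ?_).trans (norm_sinProd_le hz n)
    linarith [Nat.cast_nonneg (α := ℝ) n]

theorem hypCoeff_euler (z : ℂ) (m : ℕ) : (m : ℂ) * hypCoeff z m = -z ^ 2 * hypCoeff₂ z m := by
  cases m with
  | zero => simp [hypCoeff₂]
  | succ m =>
    have := natCast_succ_ne_zero m
    rw [hypCoeff, hypCoeff₂]
    push_cast
    field_simp

theorem hypCoeff₂_succ_mul (z : ℂ) (m : ℕ) :
    ((m : ℂ) + 1) * hypCoeff₂ z (m + 1) = ∑ k ∈ range (m + 1), hypCoeff z k := by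
  have := natCast_succ_ne_zero m
  rw [sum_hypCoeff, hypCoeff₂]
  field_simp

theorem powSum_const_mul (c : ℂ) (a : ℕ → ℂ) (x : ℝ) :
    powSum (fun m => c * a m) x = c * powSum a x := by
  simp only [powSum, mul_assoc, tsum_mul_left]

theorem hasDerivAt_hyp {z : ℂ} (hz : ‖z‖ < 1) {x : ℝ} (hx0 : x ≠ 0) (hx : |x| < 1) :
    HasDerivAt (powSum (hypCoeff z)) (-z ^ 2 * powSum (hypCoeff₂ z) x / x) x := by
  rw [← powSum_const_mul]
  exact hasDerivAt_powSum_euler (norm_hypCoeff_le_four hz) (hypCoeff_euler z) hx0 hx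

theorem hasDerivAt_hyp₂ {z : ℂ} (hz : ‖z‖ < 1) {x : ℝ} (hx : |x| < 1) :
    HasDerivAt (powSum (hypCoeff₂ z)) (powSum (hypCoeff z) x / (1 - x)) x :=
  hasDerivAt_powSum_one_sub (norm_hypCoeff₂_le hz) (hypCoeff₂_succ_mul z) hx

theorem ordinaryHypergeometricCoefficient_succ (a b c : ℂ) (n : ℕ) :
    ordinaryHypergeometricCoefficient a b c (n + 1) = ordinaryHypergeometricCoefficient a b c n *
      ((a + n) * (b + n) / (((n : ℂ) + 1) * (c + n))) := by
  simp only [ordinaryHypergeometricCoefficient, ascPochhammer_succ_eval, Nat.factorial_succ]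
  push_cast
  rw [mul_inv, mul_inv, div_eq_mul_inv, mul_inv]
  ring

theorem hypCoeff_succ (z : ℂ) (n : ℕ) :
    hypCoeff z (n + 1) = hypCoeff z n * ((z + n) * (-z + n) / (((n : ℂ) + 1) * (1 + n))) := by
  cases n with
  | zero => simp [hypCoeff, sinProd]; ring
  | succ n =>
    have h1 := natCast_succ_ne_zero n
    have h2 := natCast_succ_ne_zero (n + 1)
    have h3 : (1 : ℂ) + (n + 1) ≠ 0 := by push_cast at h2; rwa [add_comm]
    simp only [hypCoeff, sinProd_succ]
    push_cast at *
    field_simp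
    ring

theorem ordinaryHypergeometricCoefficient_eq_hypCoeff (z : ℂ) (n : ℕ) :
    ordinaryHypergeometricCoefficient z (-z) 1 n = hypCoeff z n := by
  induction n with
  | zero => simp [hypCoeff, ordinaryHypergeometricCoefficient]
  | succ n ih => rw [ordinaryHypergeometricCoefficient_succ, ih, hypCoeff_succ]

theorem ordinaryHypergeometricCoefficient_eq_hypCoeff₂ (z : ℂ) (n : ℕ) :
    ordinaryHypergeometricCoefficient (1 + z) (1 - z) 2 n = hypCoeff₂ z (n + 1) := by
  induction n with
  | zero => simp [hypCoeff₂, sinProd, ordinaryHypergeometricCoefficient]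
  | succ n ih =>
    have h1 := natCast_succ_ne_zero n
    have h2 := natCast_succ_ne_zero (n + 1)
    have h3 : (2 : ℂ) + n ≠ 0 := by
      have : (2 : ℂ) + n = ((n + 1 : ℕ) : ℂ) + 1 := by push_cast; ring
      rwa [this]
    rw [ordinaryHypergeometricCoefficient_succ, ih]
    simp only [hypCoeff₂, sinProd_succ]
    push_cast at *
    field_simp
    ring

theorem hypY₁_eq (x : ℝ) (z : ℂ) : hypY₁ x z = powSum (hypCoeff z) x := by
  rw [hypY₁, ordinaryHypergeometric_eq_tsum, powSum]
  refine tsum_congr fun n => ?_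
  rw [← ordinaryHypergeometricCoefficient_eq_hypCoeff, smul_eq_mul]

theorem hypY₂_eq {x : ℝ} {z : ℂ} (hz : ‖z‖ < 1) (hx0 : 0 < x) (hx1 : x ≤ 1) :
    hypY₂ x z = powSum (hypCoeff₂ z) (1 - x) := by
  have hx : |1 - x| < 1 := by rw [abs_lt]; constructor <;> linarith
  rw [hypY₂, ordinaryHypergeometric_eq_tsum, powSum,
    (summable_powSum (norm_hypCoeff₂_le hz) hx).tsum_eq_zero_add, ← tsum_mul_left]
  simp only [hypCoeff₂, zero_mul, zero_add]
  refine tsum_congr fun n => ?_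
  have := ordinaryHypergeometricCoefficient_eq_hypCoeff₂ z n
  rw [hypCoeff₂] at this
  rw [← this, smul_eq_mul]
  push_cast
  ring

/-- The value `Y₁(1, z)`. -/
def sinLim (z : ℂ) : ℂ := ∑' n, hypCoeff z n

theorem powSum_hypCoeff_one (z : ℂ) : powSum (hypCoeff z) 1 = sinLim z := by
  simp [powSum, sinLim]

theorem tendsto_sinProd {z : ℂ} (hz : ‖z‖ < 1) :
    Tendsto (sinProd z) atTop (𝓝 (sinLim z)) := by
  have h := (summable_norm_hypCoeff hz).of_norm.hasSum.tendsto_sum_nat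
  refine ((tendsto_add_atTop_iff_nat 1).2 h).congr fun n => sum_hypCoeff z n

theorem pi_mul_sinLim {z : ℂ} (hz : ‖z‖ < 1) :
    Real.pi * z * sinLim z = Complex.sin (Real.pi * z) :=
  tendsto_nhds_unique ((tendsto_sinProd hz).const_mul (Real.pi * z))
    (Complex.tendsto_euler_sin_prod z)

/-- By Euler's product a zero would make `z` an integer, and 0 is the only one in the unit disc.
There the value is 1. -/
theorem sinLim_ne_zero {z : ℂ} (hz : ‖z‖ < 1) : sinLim z ≠ 0 := by
  rcases eq_or_ne z 0 with rfl | hz0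
  · have : Tendsto (sinProd 0) atTop (𝓝 1) := by
      refine tendsto_const_nhds.congr fun n => ?_
      simp [sinProd]
    rw [tendsto_nhds_unique (tendsto_sinProd (by simp)) this]
    exact one_ne_zero
  · intro h
    have h1 := pi_mul_sinLim hz
    rw [h, mul_zero, eq_comm, Complex.sin_eq_zero_iff] at h1
    obtain ⟨k, hk⟩ := h1
    have hpi : (Real.pi : ℂ) ≠ 0 := by exact_mod_cast Real.pi_ne_zero
    have hzk : z = k := mul_left_cancel₀ hpi (by rw [hk, mul_comm])
    rw [hzk, Complex.norm_intCast] at hz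
    have : k = 0 := Int.abs_lt_one_iff.1 (by exact_mod_cast hz)
    exact hz0 (by rw [hzk, this]; simp)

theorem norm_sinProd_sub_le {z : ℂ} (hz : ‖z‖ < 1) (n : ℕ) :
    ‖sinProd z n - sinLim z‖ ≤ 8 / ((n : ℝ) + 1) := by
  have h : ∀ k : ℕ, ‖sinProd z n - sinProd z (n + k)‖ ≤ 8 / ((n : ℝ) + 1) - 8 / ((n : ℝ) + k + 1) := by
    intro k
    induction k with
    | zero => simp
    | succ k ih =>
      have h1 : sinProd z n - sinProd z (n + (k + 1)) =
          (sinProd z n - sinProd z (n + k)) - hypCoeff z (n + k + 1) := by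
        rw [← add_assoc, sinProd_succ, hypCoeff]; ring
      rw [h1]
      refine (norm_sub_le _ _).trans ?_
      have h2 := norm_hypCoeff_le hz (n + k)
      -- The constant 8 is what makes this telescoping bound hold already at `n + k = 0`, with
      -- equality.
      have h3 : 4 / (((n + k : ℕ) : ℝ) + 1) ^ 2 ≤ 8 / ((n : ℝ) + k + 1) - 8 / (n + k + 1 + 1) := by
        push_cast
        have hp : (0 : ℝ) ≤ (n : ℝ) + k := by positivity
        rw [← sub_nonneg]
        have : 8 / ((n : ℝ) + k + 1) - 8 / (n + k + 1 + 1) - 4 / ((n : ℝ) + k + 1) ^ 2 =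
          4 * (n + k) / ((n + k + 1) ^ 2 * (n + k + 2)) := by
          field_simp
          ring
        rw [this]
        positivity
      push_cast
      rw [← add_assoc]
      linarith
  have hl : Tendsto (fun k => ‖sinProd z n - sinProd z (n + k)‖) atTop
      (𝓝 ‖sinProd z n - sinLim z‖) := by
    have := (tendsto_add_atTop_iff_nat n).2 (tendsto_sinProd hz)
    refine ((tendsto_const_nhds (x := sinProd z n)).sub (this.congr fun k => ?_)).norm
    rw [add_comm]
  refine le_of_tendsto hl (Eventually.of_forall fun k => (h k).trans ?_)
  have : (0 : ℝ) ≤ 8 / ((n : ℝ) + k + 1) := by positivity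
  linarith

/-! ### The logarithmic singularity of `Y₂` -/

/-- The coefficients of the part of `Y₂` that stays bounded at its logarithmic singularity. -/
def regCoeff (z : ℂ) : ℕ → ℂ
  | 0 => 0
  | n + 1 => (sinProd z n - sinLim z) / ((n : ℂ) + 1)

theorem summable_norm_regCoeff {z : ℂ} (hz : ‖z‖ < 1) : Summable fun n => ‖regCoeff z n‖ := by
  rw [← summable_nat_add_iff 1]
  refine Summable.of_nonneg_of_le (fun _ => norm_nonneg _) (fun n => ?_)
    (((summable_nat_add_iff 1).2 summable_inv_sq).mul_left 8)
  rw [regCoeff, norm_div, norm_natCast_succ]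
  calc ‖sinProd z n - sinLim z‖ / ((n : ℝ) + 1) ≤ 8 / ((n : ℝ) + 1) / ((n : ℝ) + 1) := by
        gcongr; exact norm_sinProd_sub_le hz n
    _ = _ := by push_cast; rw [div_div, ← sq, div_eq_mul_inv]

/-- The coefficients `sinProd z n / (n + 1)` approach `sinLim z / (n + 1)`, whose series is the
logarithm; the remainder is absolutely summable. -/
theorem powSum_hypCoeff₂_one_sub {z : ℂ} (hz : ‖z‖ < 1) {x : ℝ} (hx0 : 0 < x) (hx1 : x ≤ 1) :
    powSum (hypCoeff₂ z) (1 - x) = powSum (regCoeff z) (1 - x) - sinLim z * (Real.log x : ℂ) := by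
  have hx : |1 - x| < 1 := by rw [abs_lt]; constructor <;> linarith
  have h1 := Complex.hasSum_ofReal.2 (Real.hasSum_pow_div_log_of_abs_lt_one hx)
  rw [sub_sub_cancel] at h1
  have hr : Summable fun n => regCoeff z n * ((1 - x : ℝ) : ℂ) ^ n := by
    refine Summable.of_norm_bounded (summable_norm_regCoeff hz) fun n => ?_
    rw [norm_mul, norm_pow, Complex.norm_real, Real.norm_eq_abs]
    exact mul_le_of_le_one_right (norm_nonneg _) (pow_le_one₀ (abs_nonneg _) hx.le)
  rw [powSum, powSum, hr.tsum_eq_zero_add,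
    (summable_powSum (norm_hypCoeff₂_le hz) hx).tsum_eq_zero_add]
  simp only [hypCoeff₂, regCoeff, zero_mul, zero_add]
  have h2 := (h1.mul_left (sinLim z)).add ((summable_nat_add_iff 1).2 hr).hasSum
  simp only [regCoeff] at h2
  have h3 : ∀ A : ℂ, A - sinLim z * (Real.log x : ℂ) =
      sinLim z * ((-Real.log x : ℝ) : ℂ) + A := fun A => by push_cast; ring
  rw [h3, ← h2.tsum_eq]
  refine tsum_congr fun n => ?_
  push_cast
  ring

/-! ### The Gauss sum at `c = n + 1` and its derivative in `c` -/

/-- The ratio `(1)_m / (n + 1)_m`. -/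
def pochRatio (n m : ℕ) : ℝ := ∏ j ∈ range m, ((j : ℝ) + 1) / ((n : ℝ) + 1 + j)

/-- The shifted harmonic number `∑_{j < m} 1 / (n + 1 + j)`. -/
def shiftHarm (n m : ℕ) : ℝ := ∑ j ∈ range m, 1 / ((n : ℝ) + 1 + j)

theorem pochRatio_nonneg (n m : ℕ) : 0 ≤ pochRatio n m := prod_nonneg fun _ _ => by positivity

theorem shiftHarm_nonneg (n m : ℕ) : 0 ≤ shiftHarm n m := sum_nonneg fun _ _ => by positivity

theorem pochRatio_succ_right (n m : ℕ) :
    pochRatio n (m + 1) = pochRatio n m * (((m : ℝ) + 1) / ((n : ℝ) + 1 + m)) := by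
  rw [pochRatio, prod_range_succ, pochRatio]

theorem shiftHarm_succ_right (n m : ℕ) :
    shiftHarm n (m + 1) = shiftHarm n m + 1 / ((n : ℝ) + 1 + m) := by
  rw [shiftHarm, sum_range_succ, shiftHarm]

theorem pochRatio_zero (m : ℕ) : pochRatio 0 m = 1 := by
  refine prod_eq_one fun j _ => ?_
  rw [Nat.cast_zero, zero_add, add_comm, div_self (by positivity)]

theorem pochRatio_succ_left (n m : ℕ) :
    pochRatio (n + 1) m = pochRatio n m * (((n : ℝ) + 1) / ((n : ℝ) + 1 + m)) := by
  induction m with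
  | zero => simp [pochRatio, div_self (by positivity : (n : ℝ) + 1 ≠ 0)]
  | succ m ih =>
    rw [pochRatio_succ_right, pochRatio_succ_right, ih]
    push_cast
    field_simp
    ring

theorem shiftHarm_succ_left (n m : ℕ) :
    shiftHarm (n + 1) m = shiftHarm n m + 1 / ((n : ℝ) + 1 + m) - 1 / ((n : ℝ) + 1) := by
  induction m with
  | zero => simp [shiftHarm]
  | succ m ih =>
    rw [shiftHarm_succ_right, shiftHarm_succ_right, ih]
    push_cast
    rw [show (n : ℝ) + 1 + 1 + m = n + 1 + (m + 1) by ring]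
    ring

theorem pochRatio_le (n m : ℕ) : pochRatio n (m + 1) ≤ 1 / ((n : ℝ) + 1) := by
  induction m with
  | zero => simp [pochRatio]
  | succ m ih =>
    rw [pochRatio_succ_right]
    refine (mul_le_of_le_one_right (pochRatio_nonneg _ _) ?_).trans ih
    rw [div_le_one (by positivity)]
    linarith [Nat.cast_nonneg (α := ℝ) n]

theorem pochRatio_le_one (n m : ℕ) : pochRatio n m ≤ 1 := by
  cases m with
  | zero => simp [pochRatio]
  | succ m =>
    refine (pochRatio_le n m).trans ?_
    rw [div_le_one (by positivity)]
    linarith [Nat.cast_nonneg (α := ℝ) n]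

theorem shiftHarm_le_zero (n m : ℕ) : shiftHarm n m ≤ shiftHarm 0 m := by
  refine sum_le_sum fun j _ => ?_
  gcongr
  simp

/-- A square root replaces the logarithm. Against `hypCoeff z m = O(m⁻²)` it leaves `m ^ (-3/2)`,
which is summable and still tends to 0 after multiplication by `m`. -/
theorem shiftHarm_le_sqrt (n m : ℕ) : shiftHarm n m ≤ 2 * √(m : ℝ) := by
  refine (shiftHarm_le_zero n m).trans ?_
  induction m with
  | zero => simp [shiftHarm]
  | succ m ih =>
    rw [shiftHarm_succ_right]
    have ha : 0 ≤ √(m : ℝ) := Real.sqrt_nonneg _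
    have hb : 1 ≤ √((m : ℝ) + 1) := Real.one_le_sqrt.2 (by linarith [Nat.cast_nonneg (α := ℝ) m])
    have ha2 : √(m : ℝ) ^ 2 = m := Real.sq_sqrt (by positivity)
    have hb2 : √((m : ℝ) + 1) ^ 2 = m + 1 := Real.sq_sqrt (by positivity)
    have hab : √(m : ℝ) ≤ √((m : ℝ) + 1) := Real.sqrt_le_sqrt (by linarith)
    have : 1 / (((0 : ℕ) : ℝ) + 1 + m) ≤ 2 * (√((m : ℝ) + 1) - √(m : ℝ)) := by
      rw [Nat.cast_zero, zero_add, add_comm, div_le_iff₀ (by positivity)]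
      set b := √((m : ℝ) + 1)
      set a := √(m : ℝ)
      have h1 : (b - a) * (b + a) = 1 := by linear_combination hb2 - ha2
      have h2 : b + a ≤ 2 * b ^ 2 := by nlinarith
      have h3 : 0 ≤ b - a := by linarith
      rw [← hb2]
      nlinarith [mul_le_mul_of_nonneg_left h2 h3]
    push_cast
    linarith

theorem norm_hypCoeff_mul_shiftHarm_le {z : ℂ} (hz : ‖z‖ < 1) (n m : ℕ) :
    ‖hypCoeff z m‖ * shiftHarm n m ≤ 8 * (m : ℝ) ^ (-(3 / 2) : ℝ) := by
  cases m with
  | zero => simp [shiftHarm]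
  | succ m =>
    have h1 := norm_hypCoeff_le hz m
    have h2 := shiftHarm_le_sqrt n (m + 1)
    have hm : (0 : ℝ) < (m : ℝ) + 1 := by positivity
    have e : ((m : ℝ) + 1) ^ (-(3 / 2) : ℝ) = √((m : ℝ) + 1) / ((m : ℝ) + 1) ^ 2 := by
      rw [Real.sqrt_eq_rpow, ← Real.rpow_natCast ((m : ℝ) + 1) 2, ← Real.rpow_sub hm]
      norm_num
    push_cast at h2 ⊢
    rw [e]
    calc ‖hypCoeff z (m + 1)‖ * shiftHarm n (m + 1)
        ≤ 4 / ((m : ℝ) + 1) ^ 2 * (2 * √((m : ℝ) + 1)) :=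
          mul_le_mul h1 h2 (shiftHarm_nonneg _ _) (by positivity)
      _ = _ := by ring

theorem summable_norm_hypCoeff_mul_shiftHarm {z : ℂ} (hz : ‖z‖ < 1) (n : ℕ) :
    Summable fun m => ‖hypCoeff z m‖ * shiftHarm n m := by
  refine Summable.of_nonneg_of_le (fun m => mul_nonneg (norm_nonneg _) (shiftHarm_nonneg _ _))
    (norm_hypCoeff_mul_shiftHarm_le hz n) (Summable.mul_left 8 ?_)
  exact Real.summable_nat_rpow.2 (by norm_num)

/-- The Gauss sum `F(z, -z; n + 1; 1)`. -/
def hypGauss (z : ℂ) (n : ℕ) : ℂ := ∑' m, hypCoeff z m * pochRatio n m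

/-- The derivative of `c ↦ F(z, -z; c; 1)` at `c = n + 1`. -/
def hypGaussDeriv (z : ℂ) (n : ℕ) : ℂ := -∑' m, hypCoeff z m * pochRatio n m * shiftHarm n m

theorem hypGauss_zero (z : ℂ) : hypGauss z 0 = sinLim z := by
  simp [hypGauss, sinLim, pochRatio_zero]

theorem summable_hypGauss {z : ℂ} (hz : ‖z‖ < 1) (n : ℕ) :
    Summable fun m => hypCoeff z m * (pochRatio n m : ℂ) := by
  refine Summable.of_norm_bounded (summable_norm_hypCoeff hz) fun m => ?_
  rw [norm_mul, Complex.norm_real, Real.norm_of_nonneg (pochRatio_nonneg _ _)]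
  exact mul_le_of_le_one_right (norm_nonneg _) (pochRatio_le_one _ _)

theorem norm_hypGaussDeriv_term_le (z : ℂ) (n m : ℕ) :
    ‖hypCoeff z m * (pochRatio n m : ℂ) * (shiftHarm n m : ℂ)‖ ≤
      1 / ((n : ℝ) + 1) * (‖hypCoeff z m‖ * shiftHarm 0 m) := by
  cases m with
  | zero => simp [shiftHarm]
  | succ m =>
    rw [norm_mul, norm_mul, Complex.norm_real, Complex.norm_real,
      Real.norm_of_nonneg (pochRatio_nonneg _ _), Real.norm_of_nonneg (shiftHarm_nonneg _ _)]
    calc ‖hypCoeff z (m + 1)‖ * pochRatio n (m + 1) * shiftHarm n (m + 1)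
        ≤ ‖hypCoeff z (m + 1)‖ * (1 / ((n : ℝ) + 1)) * shiftHarm 0 (m + 1) := by
          gcongr
          · exact shiftHarm_nonneg _ _
          · exact pochRatio_le n m
          · exact shiftHarm_le_zero n _
      _ = _ := by ring

theorem summable_hypGaussDeriv {z : ℂ} (hz : ‖z‖ < 1) (n : ℕ) :
    Summable fun m => hypCoeff z m * (pochRatio n m : ℂ) * (shiftHarm n m : ℂ) :=
  Summable.of_norm_bounded ((summable_norm_hypCoeff_mul_shiftHarm hz 0).mul_left _)
    (norm_hypGaussDeriv_term_le z n)

/-- The term `m = 0` vanishes because `shiftHarm n 0 = 0`; all others carry `pochRatio n m ≤ 1 / (n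
+ 1)`. -/
theorem tendsto_hypGaussDeriv {z : ℂ} (hz : ‖z‖ < 1) :
    Tendsto (hypGaussDeriv z) atTop (𝓝 0) := by
  have hs := (summable_norm_hypCoeff_mul_shiftHarm hz 0).hasSum
  refine squeeze_zero_norm (a := fun n : ℕ => 1 / ((n : ℝ) + 1) *
    ∑' m, ‖hypCoeff z m‖ * shiftHarm 0 m) (fun n => ?_) ?_
  · rw [hypGaussDeriv, norm_neg]
    exact tsum_of_norm_bounded (hs.mul_left _) (norm_hypGaussDeriv_term_le z n)
  · simpa using tendsto_one_div_add_atTop_nhds_zero_nat.mul_const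
      (∑' m, ‖hypCoeff z m‖ * shiftHarm 0 m)

theorem tendsto_natCast_mul_hypCoeff {z : ℂ} (hz : ‖z‖ < 1) (n : ℕ) :
    Tendsto (fun m : ℕ => (m : ℂ) * hypCoeff z m * pochRatio n m) atTop (𝓝 0) := by
  rw [← tendsto_add_atTop_iff_nat 1]
  refine squeeze_zero_norm (a := fun m : ℕ => 4 * (1 / ((m : ℝ) + 1))) (fun m => ?_) ?_
  · rw [norm_mul, norm_mul, Complex.norm_real, Complex.norm_natCast,
      Real.norm_of_nonneg (pochRatio_nonneg _ _)]
    have hm : (0 : ℝ) < (m : ℝ) + 1 := by positivity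
    push_cast
    calc ((m : ℝ) + 1) * ‖hypCoeff z (m + 1)‖ * pochRatio n (m + 1)
        ≤ ((m : ℝ) + 1) * (4 / ((m : ℝ) + 1) ^ 2) * 1 := by
          gcongr
          · exact pochRatio_nonneg _ _
          · exact norm_hypCoeff_le hz m
          · exact pochRatio_le_one _ _
      _ = _ := by field_simp
  · simpa using tendsto_one_div_add_atTop_nhds_zero_nat.const_mul (4 : ℝ)

theorem tendsto_rpow_neg_half :
    Tendsto (fun m : ℕ => 8 * (m : ℝ) ^ (-(1 / 2) : ℝ)) atTop (𝓝 0) := by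
  simpa using ((tendsto_rpow_neg_atTop (y := 1 / 2) (by norm_num)).comp
    tendsto_natCast_atTop_atTop).const_mul (8 : ℝ)

theorem tendsto_natCast_mul_hypCoeff_mul_shiftHarm {z : ℂ} (hz : ‖z‖ < 1) (n : ℕ) :
    Tendsto (fun m : ℕ => (m : ℂ) * hypCoeff z m * pochRatio n m * shiftHarm n m) atTop (𝓝 0) := by
  refine squeeze_zero_norm (fun m => ?_) tendsto_rpow_neg_half
  rw [norm_mul, norm_mul, norm_mul, Complex.norm_real, Complex.norm_real, Complex.norm_natCast,
    Real.norm_of_nonneg (pochRatio_nonneg _ _), Real.norm_of_nonneg (shiftHarm_nonneg _ _)]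
  rcases Nat.eq_zero_or_pos m with rfl | hm
  · simp [shiftHarm]
  have hm' : (0 : ℝ) < m := by exact_mod_cast hm
  have e : (m : ℝ) ^ (-(1 / 2) : ℝ) = m * (m : ℝ) ^ (-(3 / 2) : ℝ) := by
    rw [← Real.rpow_one_add' hm'.le (by norm_num)]
    norm_num
  rw [e]
  have h1 := norm_hypCoeff_mul_shiftHarm_le hz n m
  have h0 := shiftHarm_nonneg n m
  calc (m : ℝ) * ‖hypCoeff z m‖ * pochRatio n m * shiftHarm n m
      ≤ m * ‖hypCoeff z m‖ * 1 * shiftHarm n m := by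
        gcongr; exact pochRatio_le_one _ _
    _ = m * (‖hypCoeff z m‖ * shiftHarm n m) := by ring
    _ ≤ m * (8 * (m : ℝ) ^ (-(3 / 2) : ℝ)) := by gcongr
    _ = _ := by ring

/-- The contiguous relation `F(c) = (1 - z²/c²) F(c + 1)` at `c = n + 1`, with its partial sums in
closed form. The boundary term tends to 0. -/
theorem sum_hypGauss_telescope (z : ℂ) (n M : ℕ) :
    ∑ m ∈ range M, (hypCoeff z m * (pochRatio n m : ℂ) -
      (1 - z ^ 2 / ((n : ℂ) + 1) ^ 2) * (hypCoeff z m * (pochRatio (n + 1) m : ℂ))) =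
    -((M : ℂ) * hypCoeff z M * pochRatio n M) / ((n : ℂ) + 1) := by
  induction M with
  | zero => simp
  | succ M ih =>
    have h1 := natCast_succ_ne_zero n
    have h2 := natCast_succ_ne_zero M
    have h3 : (n : ℂ) + 1 + M ≠ 0 := by
      have := natCast_succ_ne_zero (n + M)
      push_cast at this
      rwa [add_right_comm]
    have h4 : (1 : ℂ) + M ≠ 0 := by rwa [add_comm]
    rw [sum_range_succ, ih, hypCoeff_succ, pochRatio_succ_right, pochRatio_succ_left]
    push_cast
    field_simp
    ring

/-- The formal derivative in `c` of the preceding identity: differentiating `pochRatio` brings down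
`-shiftHarm`, and `1 - z²/c²` brings `2 z²/c³`. -/
theorem sum_hypGaussDeriv_telescope (z : ℂ) (n M : ℕ) :
    ∑ m ∈ range M, (-(hypCoeff z m * (pochRatio n m : ℂ) * (shiftHarm n m : ℂ)) +
      (1 - z ^ 2 / ((n : ℂ) + 1) ^ 2) *
        (hypCoeff z m * (pochRatio (n + 1) m : ℂ) * (shiftHarm (n + 1) m : ℂ)) -
      2 * z ^ 2 / ((n : ℂ) + 1) ^ 3 * (hypCoeff z m * (pochRatio (n + 1) m : ℂ))) =
    (M : ℂ) * hypCoeff z M * pochRatio n M * shiftHarm n M / ((n : ℂ) + 1) +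
      (M : ℂ) * hypCoeff z M * pochRatio n M / ((n : ℂ) + 1) ^ 2 := by
  induction M with
  | zero => simp
  | succ M ih =>
    have h1 := natCast_succ_ne_zero n
    have h2 := natCast_succ_ne_zero M
    have h3 : (n : ℂ) + 1 + M ≠ 0 := by
      have := natCast_succ_ne_zero (n + M)
      push_cast at this
      rwa [add_right_comm]
    have h4 : (1 : ℂ) + M ≠ 0 := by rwa [add_comm]
    rw [sum_range_succ, ih, hypCoeff_succ, pochRatio_succ_right, pochRatio_succ_left,
      shiftHarm_succ_right, shiftHarm_succ_left]
    push_cast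
    field_simp
    ring

theorem hypGauss_eq {z : ℂ} (hz : ‖z‖ < 1) (n : ℕ) :
    hypGauss z n = (1 - z ^ 2 / ((n : ℂ) + 1) ^ 2) * hypGauss z (n + 1) := by
  have h1 := ((summable_hypGauss hz n).hasSum.sub
    ((summable_hypGauss hz (n + 1)).hasSum.mul_left
      (1 - z ^ 2 / ((n : ℂ) + 1) ^ 2))).tendsto_sum_nat
  simp only [sum_hypGauss_telescope] at h1
  have h2 := ((tendsto_natCast_mul_hypCoeff hz n).neg).div_const ((n : ℂ) + 1)
  simp only [neg_zero, zero_div] at h2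
  exact sub_eq_zero.1 (tendsto_nhds_unique h1 h2)

theorem hypGaussDeriv_eq {z : ℂ} (hz : ‖z‖ < 1) (n : ℕ) :
    hypGaussDeriv z n = (1 - z ^ 2 / ((n : ℂ) + 1) ^ 2) * hypGaussDeriv z (n + 1) +
      2 * z ^ 2 / ((n : ℂ) + 1) ^ 3 * hypGauss z (n + 1) := by
  have h1 := (((summable_hypGaussDeriv hz n).hasSum.neg.add
    ((summable_hypGaussDeriv hz (n + 1)).hasSum.mul_left (1 - z ^ 2 / ((n : ℂ) + 1) ^ 2))).sub
    ((summable_hypGauss hz (n + 1)).hasSum.mul_left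
      (2 * z ^ 2 / ((n : ℂ) + 1) ^ 3))).tendsto_sum_nat
  simp only [sum_hypGaussDeriv_telescope] at h1
  have h2 := ((tendsto_natCast_mul_hypCoeff_mul_shiftHarm hz n).div_const ((n : ℂ) + 1)).add
    ((tendsto_natCast_mul_hypCoeff hz n).div_const (((n : ℂ) + 1) ^ 2))
  simp only [add_zero, zero_div] at h2
  have h3 := tendsto_nhds_unique h1 h2
  rw [hypGaussDeriv, hypGaussDeriv, hypGauss]
  linear_combination h3

/-- The terms of `-2γ - ψ(1 + z) - ψ(1 - z)`. -/
def psiTerm (z : ℂ) (k : ℕ) : ℂ := 2 * z ^ 2 / (((k : ℂ) + 1) * (((k : ℂ) + 1) ^ 2 - z ^ 2))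

theorem succ_sq_sub_ne_zero {z : ℂ} (hz : ‖z‖ < 1) (k : ℕ) : ((k : ℂ) + 1) ^ 2 - z ^ 2 ≠ 0 := by
  intro h
  have h1 : ‖((k : ℂ) + 1) ^ 2‖ = ‖z ^ 2‖ := by rw [sub_eq_zero.1 h]
  rw [norm_pow, norm_pow, norm_natCast_succ] at h1
  have h2 : ‖z‖ ^ 2 < 1 := pow_lt_one₀ (norm_nonneg _) hz two_ne_zero
  nlinarith [Nat.cast_nonneg (α := ℝ) k]

/-- Iterating the two contiguous relations `n` times. Each step adds the logarithmic derivative of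
`1 - z²/c²` at `c = k + 1`, which is `psiTerm z k`. -/
theorem hypGaussDeriv_zero_eq {z : ℂ} (hz : ‖z‖ < 1) (n : ℕ) :
    hypGaussDeriv z 0 = sinLim z * ∑ k ∈ range n, psiTerm z k + sinProd z n * hypGaussDeriv z n ∧
      sinLim z = sinProd z n * hypGauss z n := by
  induction n with
  | zero => simp [sinProd, hypGauss_zero]
  | succ n ih =>
    have h1 := natCast_succ_ne_zero n
    have h2 := succ_sq_sub_ne_zero hz n
    have hE : sinLim z = sinProd z (n + 1) * hypGauss z (n + 1) := by
      rw [ih.2, hypGauss_eq hz, sinProd_succ]; ring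
    refine ⟨?_, hE⟩
    rw [ih.1, hypGaussDeriv_eq hz, sum_range_succ, sinProd_succ, psiTerm]
    have h3 : sinLim z * (2 * z ^ 2 / (((n : ℂ) + 1) * (((n : ℂ) + 1) ^ 2 - z ^ 2))) =
        sinProd z n * (2 * z ^ 2 / ((n : ℂ) + 1) ^ 3 * hypGauss z (n + 1)) := by
      rw [hE, sinProd_succ]
      field_simp
    linear_combination -h3

theorem tendsto_sum_psiTerm {z : ℂ} (hz : ‖z‖ < 1) :
    Tendsto (fun n => ∑ k ∈ range n, psiTerm z k) atTop (𝓝 (hypGaussDeriv z 0 / sinLim z)) := by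
  have h0 := sinLim_ne_zero hz
  have h1 := (tendsto_const_nhds (x := hypGaussDeriv z 0)).sub
    ((tendsto_sinProd hz).mul (tendsto_hypGaussDeriv hz))
  have h2 := h1.div_const (sinLim z)
  rw [mul_zero, sub_zero] at h2
  refine h2.congr fun n => ?_
  rw [(hypGaussDeriv_zero_eq hz n).1, add_sub_cancel_right, mul_div_cancel_left₀ _ h0]

theorem sum_regCoeff (z : ℂ) (M : ℕ) : ∑ n ∈ range (M + 1), regCoeff z n =
    shiftHarm 0 M * (sinProd z M - sinLim z) -
      ∑ m ∈ range (M + 1), hypCoeff z m * (pochRatio 0 m : ℂ) * (shiftHarm 0 m : ℂ) := by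
  induction M with
  | zero => simp [regCoeff, shiftHarm]
  | succ M ih =>
    rw [sum_range_succ, ih, sum_range_succ _ (M + 1), sinProd_succ, hypCoeff, regCoeff,
      shiftHarm_succ_right, pochRatio_zero]
    push_cast
    rw [show (0 : ℂ) + 1 + M = M + 1 by ring]
    ring

/-- Summation by parts (`sum_regCoeff`) moves the harmonic numbers onto `hypCoeff`, whose partial
sums are `sinProd`. The boundary term is `O(√M / M)`. -/
theorem tsum_regCoeff {z : ℂ} (hz : ‖z‖ < 1) : ∑' n, regCoeff z n = hypGaussDeriv z 0 := by
  have h1 := (tendsto_add_atTop_iff_nat 1).2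
    (summable_norm_regCoeff hz).of_norm.hasSum.tendsto_sum_nat
  have h2 := (tendsto_add_atTop_iff_nat 1).2 (summable_hypGaussDeriv hz 0).hasSum.tendsto_sum_nat
  have h3 : Tendsto (fun M : ℕ => (shiftHarm 0 M : ℂ) * (sinProd z M - sinLim z)) atTop (𝓝 0) := by
    refine squeeze_zero_norm (a := fun m : ℕ => 2 * (8 * (m : ℝ) ^ (-(1 / 2) : ℝ))) (fun m => ?_)
      (by simpa using tendsto_rpow_neg_half.const_mul 2)
    rw [norm_mul, Complex.norm_real, Real.norm_of_nonneg (shiftHarm_nonneg _ _)]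
    rcases Nat.eq_zero_or_pos m with rfl | hm
    · simp [shiftHarm]
    have hm' : (0 : ℝ) < m := by exact_mod_cast hm
    have e : (m : ℝ) ^ (-(1 / 2) : ℝ) = √(m : ℝ) / m := by
      rw [Real.sqrt_eq_rpow, eq_div_iff hm'.ne', ← Real.rpow_add_one' hm'.le (by norm_num)]
      norm_num
    rw [e]
    calc shiftHarm 0 m * ‖sinProd z m - sinLim z‖ ≤ 2 * √(m : ℝ) * (8 / m) := by
          refine mul_le_mul (shiftHarm_le_sqrt 0 m) ((norm_sinProd_sub_le hz m).trans ?_)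
            (norm_nonneg _) (by positivity)
          gcongr
          linarith
      _ = _ := by ring
  have h4 := h3.sub h2
  rw [zero_sub] at h4
  exact tendsto_nhds_unique (h1.congr fun M => sum_regCoeff z M) h4

/-! ### The digamma series and `G` -/

theorem differentiableAt_log_Gamma {x : ℝ} (hx : 0 < x) :
    DifferentiableAt ℝ (Real.log ∘ Real.Gamma) x :=
  (Real.differentiableAt_Gamma fun m => by linarith [Nat.cast_nonneg (α := ℝ) m]).log
    (Real.Gamma_pos_of_pos hx).ne'

theorem deriv_log_Gamma_add_one {x : ℝ} (hx : 0 < x) :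
    deriv (Real.log ∘ Real.Gamma) (x + 1) = deriv (Real.log ∘ Real.Gamma) x + 1 / x := by
  rw [← deriv_comp_add_const, one_div, ← Real.deriv_log,
    ← deriv_add (differentiableAt_log_Gamma hx) (Real.differentiableAt_log hx.ne')]
  apply EventuallyEq.deriv_eq
  filter_upwards [eventually_gt_nhds hx] with y hy
  simp only [Function.comp_apply, Pi.add_apply, Real.Gamma_add_one hy.ne',
    Real.log_mul hy.ne' (Real.Gamma_pos_of_pos hy).ne', add_comm]

theorem monotoneOn_deriv_log_Gamma :
    MonotoneOn (deriv (Real.log ∘ Real.Gamma)) (Set.Ioi 0) :=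
  Real.convexOn_log_Gamma.monotoneOn_deriv fun _ hx => differentiableAt_log_Gamma hx

theorem deriv_log_Gamma_add_nat {x : ℝ} (hx : 0 ≤ x) (n : ℕ) :
    deriv (Real.log ∘ Real.Gamma) (n + 1 + x) =
      deriv (Real.log ∘ Real.Gamma) (1 + x) + ∑ k ∈ range n, 1 / ((k : ℝ) + 1 + x) := by
  induction n with
  | zero => simp
  | succ n ih =>
    rw [sum_range_succ, ← add_assoc, ← ih, ← deriv_log_Gamma_add_one (by positivity)]
    congr 1
    push_cast
    ring

/-- The recurrence leaves a remainder `ψ(n + 1 + x) - ψ(n + 1)`. Since `log Γ` is convex, `ψ`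
increases, so for `0 ≤ x ≤ 1` the remainder lies between 0 and `ψ(n + 2) - ψ(n + 1) = 1 / (n + 1)`.
-/
theorem hasSum_deriv_log_Gamma {x : ℝ} (hx0 : 0 ≤ x) (hx1 : x ≤ 1) :
    HasSum (fun k : ℕ => 1 / ((k : ℝ) + 1) - 1 / ((k : ℝ) + 1 + x))
      (deriv (Real.log ∘ Real.Gamma) (1 + x) - deriv (Real.log ∘ Real.Gamma) 1) := by
  rw [hasSum_iff_tendsto_nat_of_nonneg]
  swap
  · intro k
    rw [sub_nonneg]
    exact one_div_le_one_div_of_le (by positivity) (by linarith)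
  have key : ∀ n : ℕ, ∑ k ∈ range n, (1 / ((k : ℝ) + 1) - 1 / ((k : ℝ) + 1 + x)) =
      deriv (Real.log ∘ Real.Gamma) (1 + x) - deriv (Real.log ∘ Real.Gamma) 1 -
      (deriv (Real.log ∘ Real.Gamma) (n + 1 + x) - deriv (Real.log ∘ Real.Gamma) (n + 1)) := by
    intro n
    have h1 := deriv_log_Gamma_add_nat hx0 n
    have h2 := deriv_log_Gamma_add_nat le_rfl n
    simp only [add_zero] at h2
    rw [sum_sub_distrib, h1, h2]
    ring
  have hlim : Tendsto (fun n : ℕ => deriv (Real.log ∘ Real.Gamma) (n + 1 + x) -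
      deriv (Real.log ∘ Real.Gamma) (n + 1)) atTop (𝓝 0) := by
    refine squeeze_zero (fun n => ?_) (fun n => ?_) tendsto_one_div_add_atTop_nhds_zero_nat
    · rw [sub_nonneg]
      exact monotoneOn_deriv_log_Gamma (Set.mem_Ioi.2 (by positivity))
        (Set.mem_Ioi.2 (by positivity)) (by linarith)
    · rw [sub_le_iff_le_add', ← deriv_log_Gamma_add_one (by positivity)]
      exact monotoneOn_deriv_log_Gamma (Set.mem_Ioi.2 (by positivity))
        (Set.mem_Ioi.2 (by positivity)) (by linarith)
  have h := (tendsto_const_nhds (x := deriv (Real.log ∘ Real.Gamma) (1 + x) -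
    deriv (Real.log ∘ Real.Gamma) 1)).sub hlim
  rw [sub_zero] at h
  exact h.congr fun n => (key n).symm

theorem digamma_ofReal {x : ℝ} (hx : 0 < x) :
    Complex.digamma x = ((deriv (Real.log ∘ Real.Gamma) x : ℝ) : ℂ) := by
  have hd : DifferentiableAt ℂ Complex.Gamma x := by
    refine Complex.differentiableAt_Gamma _ fun m h => ?_
    have h' : x = -(m : ℝ) := by exact_mod_cast h
    linarith [Nat.cast_nonneg (α := ℝ) m]
  have hr : DifferentiableAt ℝ Real.Gamma x :=
    Real.differentiableAt_Gamma fun m => by linarith [Nat.cast_nonneg (α := ℝ) m]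
  have h1 : deriv Complex.Gamma x = ((deriv Real.Gamma x : ℝ) : ℂ) := by
    have e1 := hd.hasDerivAt.comp_ofReal
    have e2 := hr.hasDerivAt.ofReal_comp
    simp only [Complex.Gamma_ofReal] at e1
    exact e1.unique e2
  rw [Complex.digamma_def, logDeriv_apply, h1, Complex.Gamma_ofReal, Function.comp_def,
    deriv.log hr (Real.Gamma_pos_of_pos hx).ne']
  push_cast
  rfl

theorem differentiableOn_digamma : DifferentiableOn ℂ Complex.digamma {s | 0 < s.re} := by
  have hU : IsOpen {s : ℂ | 0 < s.re} := isOpen_lt continuous_const Complex.continuous_re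
  have hne : ∀ s ∈ {s : ℂ | 0 < s.re}, ∀ m : ℕ, s ≠ -m := by
    rintro s hs m rfl
    simp only [Set.mem_ofPred_eq, Complex.neg_re, Complex.natCast_re] at hs
    linarith [Nat.cast_nonneg (α := ℝ) m]
  have h1 : DifferentiableOn ℂ Complex.Gamma {s : ℂ | 0 < s.re} := fun s hs =>
    (Complex.differentiableAt_Gamma s (hne s hs)).differentiableWithinAt
  have h2 := (h1.deriv hU).div h1 fun s hs => Complex.Gamma_ne_zero (hne s hs)
  exact h2

theorem norm_digamma_term_le {r : ℝ} (hr : r < 1) {z : ℂ} (hz : ‖z‖ < r) (n : ℕ) :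
    ‖z / (((n : ℂ) + 1) * ((n : ℂ) + 1 + z))‖ ≤ (1 - r)⁻¹ * (((n + 1 : ℕ) : ℝ) ^ 2)⁻¹ := by
  have hr0 : 0 < r := (norm_nonneg _).trans_lt hz
  have h1 : (1 - r) * ((n : ℝ) + 1) ≤ ‖(n : ℂ) + 1 + z‖ := by
    have h := norm_sub_norm_le ((n : ℂ) + 1) (-z)
    rw [sub_neg_eq_add, norm_neg, norm_natCast_succ] at h
    nlinarith [Nat.cast_nonneg (α := ℝ) n]
  rw [norm_div, norm_mul, norm_natCast_succ, ← mul_inv, ← one_div]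
  have h2 : 0 < 1 - r := by linarith
  push_cast
  refine div_le_div₀ zero_le_one (hz.le.trans hr.le) (by positivity) ?_
  calc (1 - r) * ((n : ℝ) + 1) ^ 2 = ((n : ℝ) + 1) * ((1 - r) * ((n : ℝ) + 1)) := by ring
    _ ≤ _ := by gcongr

theorem hasSum_digamma {z : ℂ} (hz : ‖z‖ < 1) :
    HasSum (fun n : ℕ => z / (((n : ℂ) + 1) * ((n : ℂ) + 1 + z)))
      (Complex.digamma (1 + z) - Complex.digamma 1) := by
  obtain ⟨r, hzr, hr⟩ := exists_between hz
  have hr0 : 0 < r := (norm_nonneg _).trans_lt hzr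
  have hu : Summable fun n : ℕ => (1 - r)⁻¹ * (((n + 1 : ℕ) : ℝ) ^ 2)⁻¹ :=
    ((summable_nat_add_iff 1).2 summable_inv_sq).mul_left _
  have hs : Summable fun n : ℕ => z / (((n : ℂ) + 1) * ((n : ℂ) + 1 + z)) :=
    Summable.of_norm_bounded hu fun n => norm_digamma_term_le hr hzr n
  have hball : ∀ w ∈ Metric.ball (0 : ℂ) r, ‖w‖ < r := fun w hw => mem_ball_zero_iff.1 hw
  have hd1 : DifferentiableOn ℂ (fun w : ℂ => ∑' n : ℕ, w / (((n : ℂ) + 1) * ((n : ℂ) + 1 + w)))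
      (Metric.ball 0 r) := by
    refine Complex.differentiableOn_tsum_of_summable_norm hu (fun n w hw => ?_) Metric.isOpen_ball
      fun n w hw => norm_digamma_term_le hr (hball w hw) n
    refine DifferentiableAt.differentiableWithinAt ?_
    refine DifferentiableAt.div (by fun_prop) (by fun_prop)
      (mul_ne_zero (natCast_succ_ne_zero n) fun h => ?_)
    have h1 : ‖(n : ℂ) + 1‖ = ‖w‖ := by rw [eq_neg_of_add_eq_zero_left h, norm_neg]
    rw [norm_natCast_succ] at h1
    linarith [hball w hw, Nat.cast_nonneg (α := ℝ) n]
  have hd2 : DifferentiableOn ℂ (fun w : ℂ => Complex.digamma (1 + w) - Complex.digamma 1)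
      (Metric.ball 0 r) := by
    refine DifferentiableOn.sub_const (differentiableOn_digamma.comp (t := {s | 0 < s.re})
      (f := fun w => 1 + w) (by fun_prop) fun w hw => ?_) _
    have h1 := (abs_le.1 (Complex.abs_re_le_norm w)).1
    have h2 := hball w hw
    simp only [Set.mem_ofPred_eq, Complex.add_re, Complex.one_re]
    linarith
  -- The real case gives equality on points of `(0, 1)` accumulating at 0; the identity theorem
  -- spreads it over the disc.
  have hfreq : ∃ᶠ w in 𝓝[≠] (0 : ℂ), (∑' n : ℕ, w / (((n : ℂ) + 1) * ((n : ℂ) + 1 + w))) =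
      Complex.digamma (1 + w) - Complex.digamma 1 := by
    have ht : Tendsto (fun x : ℝ => (x : ℂ)) (𝓝[>] 0) (𝓝[≠] 0) := by
      refine tendsto_nhdsWithin_iff.2 ⟨?_, ?_⟩
      · exact (Complex.continuous_ofReal.tendsto' 0 0 (by simp)).mono_left nhdsWithin_le_nhds
      · filter_upwards [self_mem_nhdsWithin] with x hx
        simpa using (Set.mem_Ioi.1 hx).ne'
    refine ht.frequently (Eventually.frequently ?_)
    filter_upwards [self_mem_nhdsWithin, Ioo_mem_nhdsGT one_pos] with x hx hx1
    have hx0 : 0 < x := hx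
    have h1 := Complex.hasSum_ofReal.2 (hasSum_deriv_log_Gamma hx0.le hx1.2.le)
    have e1 : Complex.digamma (1 + x) - Complex.digamma 1 =
        ((deriv (Real.log ∘ Real.Gamma) (1 + x) - deriv (Real.log ∘ Real.Gamma) 1 : ℝ) : ℂ) := by
      have h3 := digamma_ofReal (x := 1 + x) (by linarith)
      have h4 := digamma_ofReal (x := 1) one_pos
      push_cast at h3 h4 ⊢
      rw [h3, h4]
    rw [e1, ← h1.tsum_eq]
    refine tsum_congr fun n => ?_
    have h5 := natCast_succ_ne_zero n
    have h6 : (n : ℂ) + 1 + x ≠ 0 := by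
      have : (n : ℝ) + 1 + x ≠ 0 := by positivity
      exact_mod_cast this
    push_cast
    field_simp
    ring
  have heq := AnalyticOnNhd.eqOn_of_preconnected_of_frequently_eq
    (hd1.analyticOnNhd Metric.isOpen_ball) (hd2.analyticOnNhd Metric.isOpen_ball)
    (convex_ball _ _).isPreconnected (Metric.mem_ball_self hr0) hfreq
  have := heq (mem_ball_zero_iff.2 hzr)
  simp only at this
  rw [← this]
  exact hs.hasSum

theorem hasSum_psiTerm {z : ℂ} (hz : ‖z‖ < 1) :
    HasSum (psiTerm z) (2 * Complex.digamma 1 - Complex.digamma (1 + z) -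
      Complex.digamma (1 - z)) := by
  have h := ((hasSum_digamma hz).add (hasSum_digamma (z := -z) (by rwa [norm_neg]))).neg
  rw [← sub_eq_add_neg 1 z] at h
  have e : -(Complex.digamma (1 + z) - Complex.digamma 1 +
      (Complex.digamma (1 - z) - Complex.digamma 1)) =
      2 * Complex.digamma 1 - Complex.digamma (1 + z) - Complex.digamma (1 - z) := by ring
  rw [e] at h
  refine h.congr_fun fun n => ?_
  have h0 := succ_sq_sub_ne_zero hz n
  have h1 := natCast_succ_ne_zero n
  have h2 : ((n : ℂ) + 1 + z) * ((n : ℂ) + 1 + -z) ≠ 0 := by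
    rw [show ((n : ℂ) + 1 + z) * ((n : ℂ) + 1 + -z) = ((n : ℂ) + 1) ^ 2 - z ^ 2 by ring]
    exact h0
  have h3 := left_ne_zero_of_mul h2
  have h4 := right_ne_zero_of_mul h2
  rw [psiTerm]
  field_simp
  ring

theorem norm_I_mul_lt {z : ℂ} (hz : ‖z‖ < 1) : ‖Complex.I * z‖ < 1 := by simpa using hz

theorem hasSum_psiG {z : ℂ} (hz : ‖z‖ < 1) :
    HasSum (fun k => (psiTerm z k - psiTerm (Complex.I * z) k) / 4) (psiG z) := by
  have h := ((hasSum_psiTerm hz).sub (hasSum_psiTerm (norm_I_mul_lt hz))).div_const 4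
  have e : psiG z = (2 * Complex.digamma 1 - Complex.digamma (1 + z) - Complex.digamma (1 - z) -
      (2 * Complex.digamma 1 - Complex.digamma (1 + Complex.I * z) -
        Complex.digamma (1 - Complex.I * z))) / 4 := by
    rw [psiG]; ring
  rw [e]
  exact h

theorem psiG_eq {z : ℂ} (hz : ‖z‖ < 1) : psiG z =
    (hypGaussDeriv z 0 / sinLim z -
      hypGaussDeriv (Complex.I * z) 0 / sinLim (Complex.I * z)) / 4 := by
  have h1 := tendsto_nhds_unique (hasSum_psiTerm hz).tendsto_sum_nat (tendsto_sum_psiTerm hz)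
  have h2 := tendsto_nhds_unique (hasSum_psiTerm (norm_I_mul_lt hz)).tendsto_sum_nat
    (tendsto_sum_psiTerm (norm_I_mul_lt hz))
  rw [← h1, ← h2, psiG]
  ring

/-! ### Solutions of the hypergeometric equation -/

theorem eq_of_hasDerivAt_zero_of_tendsto {F : ℝ → ℂ} {L : ℂ}
    (hF : ∀ x ∈ Set.Ioo (0 : ℝ) 1, HasDerivAt F 0 x) (hL : Tendsto F (𝓝[>] 0) (𝓝 L)) {x : ℝ}
    (hx : x ∈ Set.Ioo (0 : ℝ) 1) : F x = L := by
  have hc : ∀ y ∈ Set.Ioo (0 : ℝ) 1, F y = F x := fun y hy =>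
    isOpen_Ioo.is_const_of_deriv_eq_zero isPreconnected_Ioo
      (fun y hy => (hF y hy).differentiableAt.differentiableWithinAt)
      (fun y hy => (hF y hy).deriv) hy hx
  refine tendsto_nhds_unique (tendsto_const_nhds.congr' ?_) hL
  filter_upwards [Ioo_mem_nhdsGT one_pos] with y hy
  exact (hc y hy).symm

/-- `p` solves `(1 - x) d/dx (x d/dx p) = -c p` on `(0, 1)`, and `p₁ = x d/dx p`. -/
structure IsHypPair (c : ℂ) (p p₁ : ℝ → ℂ) : Prop where
  deriv_fst : ∀ x ∈ Set.Ioo (0 : ℝ) 1, HasDerivAt p (p₁ x / x) x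
  deriv_snd : ∀ x ∈ Set.Ioo (0 : ℝ) 1, HasDerivAt p₁ (-c * p x / (1 - x)) x

theorem isHypPair_hyp {z : ℂ} (hz : ‖z‖ < 1) :
    IsHypPair (z ^ 2) (powSum (hypCoeff z)) (fun x => -z ^ 2 * powSum (hypCoeff₂ z) x) where
  deriv_fst x hx := hasDerivAt_hyp hz hx.1.ne' (by rw [abs_of_pos hx.1]; exact hx.2)
  deriv_snd x hx := by
    rw [mul_div_assoc]
    exact (hasDerivAt_hyp₂ hz (by rw [abs_of_pos hx.1]; exact hx.2)).const_mul _

/-- Write `f, g` for the series with coefficients `hypCoeff z`, `hypCoeff₂ z`. In `x f' = -z² g` and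
`(1 - x) g' = f`, the reflection `x ↦ 1 - x` exchanges the roles of `f` and `g`, so `g(1 - x)` is a
second solution. -/
theorem isHypPair_hyp_one_sub {z : ℂ} (hz : ‖z‖ < 1) :
    IsHypPair (z ^ 2) (fun x => powSum (hypCoeff₂ z) (1 - x))
      (fun x => -powSum (hypCoeff z) (1 - x)) where
  deriv_fst x hx := by
    have hy : |1 - x| < 1 := by rw [abs_lt]; constructor <;> linarith [hx.1, hx.2]
    have h := (hasDerivAt_hyp₂ hz hy).scomp x ((hasDerivAt_id x).const_sub 1)
    refine h.congr_deriv ?_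
    simp only [neg_smul, one_smul]
    push_cast
    rw [sub_sub_cancel, neg_div]
  deriv_snd x hx := by
    have hy : |1 - x| < 1 := by rw [abs_lt]; constructor <;> linarith [hx.1, hx.2]
    have h := ((hasDerivAt_hyp hz (x := 1 - x) (by linarith [hx.2]) hy).scomp x
      ((hasDerivAt_id x).const_sub 1)).neg
    refine h.congr_deriv ?_
    simp only [neg_smul, one_smul, neg_neg]
    push_cast
    rfl

theorem ofReal_ne_zero_of_mem {x : ℝ} (hx : x ∈ Set.Ioo (0 : ℝ) 1) :
    (x : ℂ) ≠ 0 ∧ (1 - x : ℂ) ≠ 0 := by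
  refine ⟨by exact_mod_cast hx.1.ne', ?_⟩
  rw [sub_ne_zero]
  exact_mod_cast hx.2.ne'

theorem IsHypPair.wronskian_hasDerivAt {c : ℂ} {p p₁ q q₁ : ℝ → ℂ} (hp : IsHypPair c p p₁)
    (hq : IsHypPair c q q₁) {x : ℝ} (hx : x ∈ Set.Ioo (0 : ℝ) 1) :
    HasDerivAt (fun x => p x * q₁ x - q x * p₁ x) 0 x := by
  obtain ⟨h0, h1⟩ := ofReal_ne_zero_of_mem hx
  refine (((hp.deriv_fst x hx).mul (hq.deriv_snd x hx)).sub
    ((hq.deriv_fst x hx).mul (hp.deriv_snd x hx))).congr_deriv ?_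
  field_simp
  ring

/-! ### The conserved pairing -/

/-- The Euler derivative `x d/dx` of the generating function. -/
def genEuler (z : ℂ) : ℝ → ℂ := powSum fun m => (m : ℂ) * genCoeff z m

/-- The second Euler derivative of the generating function. -/
def genEuler₂ (z : ℂ) : ℝ → ℂ := powSum fun m => (m : ℂ) ^ 2 * genCoeff z m

theorem norm_sq_mul_genCoeff_le {z : ℂ} (hz : ‖z‖ < 1) (m : ℕ) :
    ‖(m : ℂ) ^ 2 * genCoeff z m‖ ≤ 18 := by
  rw [norm_mul, norm_pow, Complex.norm_natCast]
  refine (mul_le_mul_of_nonneg_left (norm_genCoeff_le hz m) (by positivity)).trans ?_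
  rw [mul_left_comm]
  have : (m : ℝ) ^ 2 * ((m : ℝ) ^ 2)⁻¹ ≤ 1 := mul_inv_le_one
  linarith

theorem norm_mul_genCoeff_le {z : ℂ} (hz : ‖z‖ < 1) (m : ℕ) : ‖(m : ℂ) * genCoeff z m‖ ≤ 18 := by
  refine le_trans ?_ (norm_sq_mul_genCoeff_le hz m)
  rw [norm_mul, norm_mul, norm_pow, Complex.norm_natCast]
  gcongr
  exact_mod_cast Nat.le_self_pow two_ne_zero m

theorem norm_genCoeff_le_const {z : ℂ} (hz : ‖z‖ < 1) (m : ℕ) : ‖genCoeff z m‖ ≤ 18 := by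
  rcases Nat.eq_zero_or_pos m with rfl | hm
  · simp
  refine le_trans ?_ (norm_mul_genCoeff_le hz m)
  rw [norm_mul, Complex.norm_natCast]
  exact le_mul_of_one_le_left (norm_nonneg _) (by exact_mod_cast hm)

theorem norm_genOmega_le {z : ℂ} (hz : ‖z‖ < 1) (m : ℕ) : ‖genOmega z m‖ ≤ 72 := by
  rw [genOmega]
  split_ifs with hm
  · simp
  have hm' : (0 : ℝ) < m := by exact_mod_cast Nat.pos_of_ne_zero hm
  have h1 : ‖∑ k ∈ range m, genCoeff z k‖ ≤ m * 18 := by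
    refine (norm_sum_le _ _).trans ((sum_le_sum fun k _ => norm_genCoeff_le_const hz k).trans ?_)
    simp
  have h2 : ‖z‖ ^ 2 ≤ 1 := pow_le_one₀ (norm_nonneg _) hz.le
  simp only [norm_mul, norm_neg, norm_inv, norm_pow, Complex.norm_natCast, RCLike.norm_ofNat]
  calc 4 * ‖z‖ ^ 2 * (m : ℝ)⁻¹ * ‖∑ k ∈ range m, genCoeff z k‖
      ≤ 4 * 1 * (m : ℝ)⁻¹ * (m * 18) := by gcongr
    _ = 72 := by field_simp; norm_num

/-- The pairing of the generating function with a product of two hypergeometric solutions. -/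
def genPairing (z : ℂ) (p p₁ q q₁ : ℝ → ℂ) (x : ℝ) : ℂ :=
  p x * q x * genEuler₂ z x / 2 - p x * q₁ x * (genEuler z x + powSum (genOmega z) x / 2) / 2 -
    p₁ x * q x * (genEuler z x - powSum (genOmega z) x / 2) / 2 +
    p₁ x * q₁ x * powSum (genCoeff z) x

/-- The pairing equals `p q S₂/2 - (p₁ q + p q₁) S₁/2 + p₁ q₁ S + (p₁ q - p q₁) Ω/4`. The opposite
parameters `z²` and `-z²` give `(x d/dx)² (p q) = 2 p₁ q₁`, `(1 - x) (p₁ q₁)' = z² (p₁ q - p q₁)`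
and `(1 - x) (p₁ q - p q₁)' = -2 z² p q`. With the system for `S, S₁, S₂, Ω`, all terms of the
derivative cancel in pairs. -/
theorem genPairing_hasDerivAt {z : ℂ} (hz : ‖z‖ < 1) {p p₁ q q₁ : ℝ → ℂ}
    (hp : IsHypPair (z ^ 2) p p₁) (hq : IsHypPair (-z ^ 2) q q₁) {x : ℝ}
    (hx : x ∈ Set.Ioo (0 : ℝ) 1) : HasDerivAt (genPairing z p p₁ q q₁) 0 x := by
  obtain ⟨h0, h1⟩ := ofReal_ne_zero_of_mem hx
  have hx1 : |x| < 1 := by rw [abs_of_pos hx.1]; exact hx.2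
  have hS : HasDerivAt (powSum (genCoeff z)) (genEuler z x / x) x :=
    hasDerivAt_powSum_euler (norm_genCoeff_le_const hz) (fun _ => rfl) hx.1.ne' hx1
  have hS1 : HasDerivAt (genEuler z) (genEuler₂ z x / x) x :=
    hasDerivAt_powSum_euler (norm_mul_genCoeff_le hz) (fun m => by ring) hx.1.ne' hx1
  have hQ : HasDerivAt (genEuler₂ z) (z ^ 2 * powSum (genOmega z) x / (1 - x)) x := by
    rw [← powSum_const_mul]
    exact hasDerivAt_powSum_one_sub (norm_sq_mul_genCoeff_le hz) (cube_mul_genCoeff hz) hx1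
  have hW : HasDerivAt (powSum (genOmega z)) (-4 * z ^ 2 * powSum (genCoeff z) x / (1 - x)) x := by
    rw [← powSum_const_mul]
    exact hasDerivAt_powSum_one_sub (norm_genOmega_le hz) (succ_mul_genOmega_succ z) hx1
  have dp := hp.deriv_fst x hx
  have dp₁ := hp.deriv_snd x hx
  have dq := hq.deriv_fst x hx
  have dq₁ := hq.deriv_snd x hx
  refine (((((dp.mul dq).mul hQ).div_const 2).sub
    (((dp.mul dq₁).mul (hS1.add (hW.div_const 2))).div_const 2)).sub
    (((dp₁.mul dq).mul (hS1.sub (hW.div_const 2))).div_const 2)).add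
    ((dp₁.mul dq₁).mul hS) |>.congr_deriv ?_
  simp only [Pi.mul_apply, Pi.add_apply, Pi.sub_apply]
  field_simp
  ring

/-! ### Boundary values at `x → 0` -/

/-- Growth at `0` of at most logarithmic type, in a form stable under the products needed. -/
def MildAtZero (u : ℝ → ℂ) : Prop := u =O[𝓝[>] 0] fun x : ℝ => x ^ (-(1 / 4) : ℝ)

theorem mildAtZero_of_tendsto {u : ℝ → ℂ} {L : ℂ} (h : Tendsto u (𝓝[>] 0) (𝓝 L)) :
    MildAtZero u := by
  refine (h.isBigO_one ℝ).trans (IsBigO.of_bound 1 ?_)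
  filter_upwards [Ioo_mem_nhdsGT one_pos] with x hx
  rw [norm_one, one_mul, Real.norm_of_nonneg (Real.rpow_nonneg hx.1.le _)]
  exact Real.one_le_rpow_of_pos_of_le_one_of_nonpos hx.1 hx.2.le (by norm_num)

/-- The exponent `-1/4` is chosen so that two mild factors and one `O(x)` factor leave `x ^ (1/2)`.
-/
theorem MildAtZero.tendsto_mul {u v h : ℝ → ℂ} (hu : MildAtZero u) (hv : MildAtZero v)
    (hh : h =O[𝓝[>] 0] fun x : ℝ => x) : Tendsto (fun x => u x * v x * h x) (𝓝[>] 0) (𝓝 0) := by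
  refine ((hu.mul hv).mul hh).trans_tendsto ?_
  have h1 : Tendsto (fun x : ℝ => x ^ (1 / 2 : ℝ)) (𝓝[>] 0) (𝓝 0) := by
    have := (Real.continuousAt_rpow_const 0 (1 / 2) (Or.inr (by norm_num))).tendsto
    rw [Real.zero_rpow (by norm_num)] at this
    exact this.mono_left nhdsWithin_le_nhds
  refine h1.congr' ?_
  filter_upwards [self_mem_nhdsWithin] with x hx
  have hx0 : (0 : ℝ) < x := hx
  rw [← Real.rpow_add hx0, ← Real.rpow_add_one hx0.ne']
  norm_num

theorem isBigO_powSum_sub {a : ℕ → ℂ} {C : ℝ} (ha : ∀ m, ‖a m‖ ≤ C) :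
    (fun x => powSum a x - a 0) =O[𝓝[>] 0] fun x : ℝ => x := by
  refine IsBigO.of_bound (2 * C) ?_
  filter_upwards [Ioo_mem_nhdsGT (show (0 : ℝ) < 1 / 2 by norm_num)] with x hx
  rw [Real.norm_of_nonneg hx.1.le]
  exact norm_powSum_sub_le ha hx.1.le hx.2.le

theorem isBigO_powSum {a : ℕ → ℂ} {C : ℝ} (ha : ∀ m, ‖a m‖ ≤ C) (h0 : a 0 = 0) :
    powSum a =O[𝓝[>] 0] fun x : ℝ => x := by
  simpa [h0] using isBigO_powSum_sub ha

theorem tendsto_powSum_zero {a : ℕ → ℂ} {C : ℝ} (ha : ∀ m, ‖a m‖ ≤ C) :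
    Tendsto (powSum a) (𝓝[>] 0) (𝓝 (a 0)) := by
  have h : Tendsto (fun x : ℝ => x) (𝓝[>] 0) (𝓝 0) := tendsto_id.mono_left nhdsWithin_le_nhds
  simpa using ((isBigO_powSum_sub ha).trans_tendsto h).add_const (a 0)

/-- Near 0 the series `S, S₁, S₂` and `Ω - 1` are `O(x)`, which defeats the logarithms in `p` and
`q`. Only `(p₁ q - p q₁) / 4`, from the constant term of `Ω`, survives. -/
theorem genPairing_eq {z : ℂ} (hz : ‖z‖ < 1) {p p₁ q q₁ : ℝ → ℂ} {L : ℂ}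
    (hp : IsHypPair (z ^ 2) p p₁) (hq : IsHypPair (-z ^ 2) q q₁)
    (mp : MildAtZero p) (mp₁ : MildAtZero p₁) (mq : MildAtZero q) (mq₁ : MildAtZero q₁)
    (hL : Tendsto (fun x => p₁ x * q x - p x * q₁ x) (𝓝[>] 0) (𝓝 L)) {x : ℝ}
    (hx : x ∈ Set.Ioo (0 : ℝ) 1) : genPairing z p p₁ q q₁ x = L / 4 := by
  refine eq_of_hasDerivAt_zero_of_tendsto (fun y hy => genPairing_hasDerivAt hz hp hq hy) ?_ hx
  have oS := isBigO_powSum (norm_genCoeff_le_const hz) (genCoeff_zero_right z)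
  have oS1 : genEuler z =O[𝓝[>] 0] fun x : ℝ => x :=
    isBigO_powSum (norm_mul_genCoeff_le hz) (by simp)
  have oQ : genEuler₂ z =O[𝓝[>] 0] fun x : ℝ => x :=
    isBigO_powSum (norm_sq_mul_genCoeff_le hz) (by simp)
  have oW : (fun x => powSum (genOmega z) x - 1) =O[𝓝[>] 0] fun x : ℝ => x := by
    simpa [genOmega] using isBigO_powSum_sub (norm_genOmega_le hz)
  have t1 := (mp.tendsto_mul mq oQ).div_const 2
  have t2 := (mp.tendsto_mul mq₁ oS1).div_const 2
  have t3 := (mp₁.tendsto_mul mq oS1).div_const 2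
  have t4 := mp₁.tendsto_mul mq₁ oS
  have t5 := (mp.tendsto_mul mq₁ oW).div_const 4
  have t6 := (mp₁.tendsto_mul mq oW).div_const 4
  have t := (((((t1.sub t2).sub t3).add t4).sub t5).add t6).add (hL.div_const 4)
  simp only [zero_div, sub_zero, add_zero, zero_add] at t
  refine t.congr fun y => ?_
  rw [genPairing]
  ring

theorem tendsto_one_sub_zero : Tendsto (fun x : ℝ => 1 - x) (𝓝[>] 0) (𝓝[Set.Icc 0 1] 1) := by
  refine tendsto_nhdsWithin_iff.2 ⟨?_, ?_⟩
  · exact ((continuous_const.sub continuous_id).tendsto' 0 1 (by simp)).mono_left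
      nhdsWithin_le_nhds
  · filter_upwards [Ioo_mem_nhdsGT one_pos] with x hx
    constructor <;> linarith [hx.1, hx.2]

theorem tendsto_powSum_one_sub {a : ℕ → ℂ} (ha : Summable fun m => ‖a m‖) :
    Tendsto (fun x => powSum a (1 - x)) (𝓝[>] 0) (𝓝 (∑' m, a m)) := by
  have h := (continuousOn_powSum ha 1 (by simp)).tendsto.comp tendsto_one_sub_zero
  simpa [powSum, Function.comp_def] using h

theorem mildAtZero_hyp₂_one_sub {z : ℂ} (hz : ‖z‖ < 1) :
    MildAtZero fun x => powSum (hypCoeff₂ z) (1 - x) := by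
  have h1 := mildAtZero_of_tendsto (tendsto_powSum_one_sub (summable_norm_regCoeff hz))
  have h2 : (fun x : ℝ => (Real.log x : ℂ)) =O[𝓝[>] 0] fun x : ℝ => x ^ (-(1 / 4) : ℝ) := by
    refine IsBigO.of_norm_left ?_
    simp only [Complex.norm_real]
    exact (isLittleO_log_rpow_nhdsGT_zero (by norm_num)).isBigO.norm_left
  have h3 := IsBigO.sub h1 (h2.const_mul_left (sinLim z))
  refine h3.congr' ?_ EventuallyEq.rfl
  filter_upwards [Ioo_mem_nhdsGT one_pos] with x hx
  exact (powSum_hypCoeff₂_one_sub hz hx.1 hx.2.le).symm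

theorem hypCoeff₂_zero_right (z : ℂ) : hypCoeff₂ z 0 = 0 := rfl

theorem hypCoeff_zero_right (z : ℂ) : hypCoeff z 0 = 1 := rfl

/-- The Wronskian of the two solutions is constant. At `x → 0` the first product tends to `1 *
sinLim z`, and in the second the factor `O(x)` outweighs the logarithm. -/
theorem hyp_wronskian {z : ℂ} (hz : ‖z‖ < 1) {x : ℝ} (hx : x ∈ Set.Ioo (0 : ℝ) 1) :
    powSum (hypCoeff z) x * powSum (hypCoeff z) (1 - x) -
      z ^ 2 * powSum (hypCoeff₂ z) x * powSum (hypCoeff₂ z) (1 - x) = sinLim z := by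
  have h := eq_of_hasDerivAt_zero_of_tendsto (L := -sinLim z)
    (fun y hy => (isHypPair_hyp hz).wronskian_hasDerivAt (isHypPair_hyp_one_sub hz) hy) ?_ hx
  · linear_combination -h
  have t1 := (tendsto_powSum_zero (norm_hypCoeff_le_four hz)).mul
    (tendsto_powSum_one_sub (summable_norm_hypCoeff hz))
  rw [hypCoeff_zero_right, one_mul, ← sinLim] at t1
  have t2 := ((mildAtZero_hyp₂_one_sub hz).tendsto_mul
    (mildAtZero_of_tendsto (tendsto_const_nhds (x := (1 : ℂ))))
    (isBigO_powSum (norm_hypCoeff₂_le hz) (hypCoeff₂_zero_right z))).const_mul (z ^ 2)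
  have t := t1.neg.add t2
  simp only [mul_zero, add_zero] at t
  refine t.congr fun y => ?_
  ring

/-- Continuity of `F(z, -z; 1; 1 - x)` at `x = 0` is too weak against a logarithm. The Wronskian
identity rewrites the difference as terms each containing an `O(x)` factor. -/
theorem tendsto_mild_mul_hyp_one_sub {z : ℂ} (hz : ‖z‖ < 1) {u : ℝ → ℂ} (hu : MildAtZero u) :
    Tendsto (fun x => u x * (powSum (hypCoeff z) (1 - x) - sinLim z)) (𝓝[>] 0) (𝓝 0) := by
  have oF := isBigO_powSum_sub (norm_hypCoeff_le_four hz)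
  have oG := isBigO_powSum (norm_hypCoeff₂_le hz) (hypCoeff₂_zero_right z)
  have mF := mildAtZero_of_tendsto (tendsto_powSum_one_sub (summable_norm_hypCoeff hz))
  have t := ((hu.tendsto_mul (mildAtZero_hyp₂_one_sub hz) oG).const_mul (z ^ 2)).sub
    (hu.tendsto_mul mF oF)
  rw [mul_zero, sub_zero] at t
  refine t.congr' ?_
  filter_upwards [Ioo_mem_nhdsGT one_pos] with x hx
  rw [hypCoeff_zero_right]
  linear_combination -u x * hyp_wronskian hz hx

theorem I_mul_sq (z : ℂ) : (Complex.I * z) ^ 2 = -z ^ 2 := by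
  rw [mul_pow, Complex.I_sq]; ring

/-! ### Solving the four pairings for the generating function -/

theorem powSum_genCoeff_eq {z : ℂ} (hz : ‖z‖ < 1) {x : ℝ} (hx : x ∈ Set.Ioo (0 : ℝ) 1) :
    powSum (genCoeff z) x = psiG z * powSum (hypCoeff z) x * powSum (hypCoeff (Complex.I * z)) x
      - powSum (hypCoeff (Complex.I * z)) x * powSum (hypCoeff₂ z) (1 - x) / (4 * sinLim z)
      + powSum (hypCoeff z) x * powSum (hypCoeff₂ (Complex.I * z)) (1 - x) /
        (4 * sinLim (Complex.I * z)) := by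
  set w := Complex.I * z with hw
  have hzw : ‖w‖ < 1 := norm_I_mul_lt hz
  have hw2 : w ^ 2 = -z ^ 2 := I_mul_sq z
  have p1 := isHypPair_hyp hz
  have p2 := isHypPair_hyp_one_sub hz
  have q1 := isHypPair_hyp hzw
  have q2 := isHypPair_hyp_one_sub hzw
  rw [hw2] at q1 q2
  have mf := mildAtZero_of_tendsto (tendsto_powSum_zero (norm_hypCoeff_le_four hz))
  have mg := mildAtZero_of_tendsto
    ((tendsto_powSum_zero (norm_hypCoeff₂_le hz)).const_mul (-z ^ 2))
  have mU := mildAtZero_hyp₂_one_sub hz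
  have mF := mildAtZero_of_tendsto (tendsto_powSum_one_sub (summable_norm_hypCoeff hz)).neg
  have mf' := mildAtZero_of_tendsto (tendsto_powSum_zero (norm_hypCoeff_le_four hzw))
  have mg' := mildAtZero_of_tendsto
    ((tendsto_powSum_zero (norm_hypCoeff₂_le hzw)).const_mul (- -z ^ 2))
  have mU' := mildAtZero_hyp₂_one_sub hzw
  have mF' := mildAtZero_of_tendsto (tendsto_powSum_one_sub (summable_norm_hypCoeff hzw)).neg
  have tf := tendsto_powSum_zero (norm_hypCoeff_le_four hz)
  have tf' := tendsto_powSum_zero (norm_hypCoeff_le_four hzw)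
  have tg := tendsto_powSum_zero (norm_hypCoeff₂_le hz)
  have tg' := tendsto_powSum_zero (norm_hypCoeff₂_le hzw)
  have tF := tendsto_powSum_one_sub (summable_norm_hypCoeff hz)
  have tF' := tendsto_powSum_one_sub (summable_norm_hypCoeff hzw)
  rw [hypCoeff_zero_right] at tf tf'
  rw [hypCoeff₂_zero_right] at tg tg'
  rw [← sinLim] at tF tF'
  have m1 := mildAtZero_of_tendsto (tendsto_const_nhds (x := (1 : ℂ)))
  have og := isBigO_powSum (norm_hypCoeff₂_le hz) (hypCoeff₂_zero_right z)
  have og' := isBigO_powSum (norm_hypCoeff₂_le hzw) (hypCoeff₂_zero_right w)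
  have K1 := genPairing_eq hz p1 q1 mf mg mf' mg' (L := 0) (by
    have t := ((tg.const_mul (-z ^ 2)).mul tf').sub (tf.mul (tg'.const_mul (- -z ^ 2)))
    simpa using t) hx
  have K2 := genPairing_eq hz p2 q1 mU mF mf' mg' (L := -sinLim z) (by
    have t := (tF.neg.mul tf').sub ((mU.tendsto_mul m1 og').const_mul (z ^ 2))
    simp only [mul_zero, sub_zero, mul_one] at t
    refine t.congr fun y => ?_
    ring) hx
  have K3 := genPairing_eq hz p1 q2 mf mg mU' mF' (L := sinLim w) (by
    have t := (tf.mul tF').sub ((mU'.tendsto_mul m1 og).const_mul (z ^ 2))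
    simp only [mul_zero, sub_zero, one_mul] at t
    refine t.congr fun y => ?_
    ring) hx
  have K4 := genPairing_eq hz p2 q2 mU mF mU' mF'
    (L := hypGaussDeriv z 0 * sinLim w - hypGaussDeriv w 0 * sinLim z) (by
    have tR := tendsto_powSum_one_sub (summable_norm_regCoeff hz)
    have tR' := tendsto_powSum_one_sub (summable_norm_regCoeff hzw)
    rw [tsum_regCoeff hz] at tR
    rw [tsum_regCoeff hzw] at tR'
    -- Replacing `F(1 - x)` by its limit leaves `U * sinLim w - U' * sinLim z`, in which the
    -- multiples of `log x` cancel.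
    have t := ((tendsto_mild_mul_hyp_one_sub hzw mU).sub
      (tendsto_mild_mul_hyp_one_sub hz mU')).add
      ((tR.mul_const (sinLim w)).sub (tR'.mul_const (sinLim z)))
    simp only [sub_zero, zero_add] at t
    refine t.congr' ?_
    filter_upwards [Ioo_mem_nhdsGT one_pos] with y hy
    have e1 := powSum_hypCoeff₂_one_sub hz hy.1 hy.2.le
    have e2 := powSum_hypCoeff₂_one_sub hzw hy.1 hy.2.le
    linear_combination (-sinLim w) * e1 + sinLim z * e2) hx
  have W := hyp_wronskian hz hx
  have W' := hyp_wronskian hzw hx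
  rw [hw2] at W'
  have hP := sinLim_ne_zero hz
  have hP' := sinLim_ne_zero hzw
  rw [psiG_eq hz, ← hw]
  simp only [genPairing] at K1 K2 K3 K4
  set f := powSum (hypCoeff z) x
  set g := powSum (hypCoeff₂ z) x
  set U := powSum (hypCoeff₂ z) (1 - x)
  set F := powSum (hypCoeff z) (1 - x)
  set f' := powSum (hypCoeff w) x
  set g' := powSum (hypCoeff₂ w) x
  set U' := powSum (hypCoeff₂ w) (1 - x)
  set F' := powSum (hypCoeff w) (1 - x)
  set S := powSum (genCoeff z) x
  have key : sinLim z * sinLim w * S =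
      f * f' * ((hypGaussDeriv z 0 * sinLim w - hypGaussDeriv w 0 * sinLim z) / 4) -
      U * f' * (sinLim w / 4) + f * U' * (sinLim z / 4) := by
    -- The weights are products of `(U, -f)` and `(U', -f')`. These annihilate the values of the
    -- solutions, and by `W` and `W'` send their Euler derivatives to `sinLim z` and `sinLim w`.
    -- Thus only the `p₁ q₁ S` part of the pairing remains.
    linear_combination U * U' * K1 - f * U' * K2 - U * f' * K3 + f * f' * K4 -
      S * (f' * F' + z ^ 2 * g' * U') * W - S * sinLim z * W'
  have h4 : S = (sinLim z * sinLim w * S) / (sinLim z * sinLim w) := by field_simp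
  rw [h4, key]
  field_simp

/-! ### The closed form on `(0, 1]` and its limit at 0 -/

theorem summable_norm_genCoeff {z : ℂ} (hz : ‖z‖ < 1) : Summable fun m => ‖genCoeff z m‖ :=
  Summable.of_nonneg_of_le (fun _ => norm_nonneg _) (norm_genCoeff_le hz)
    (summable_inv_sq.mul_left 18)

theorem closedForm_eq {z : ℂ} (hz : ‖z‖ < 1) {x : ℝ} (hx0 : 0 < x) (hx1 : x ≤ 1) :
    closedForm x z = psiG z * powSum (hypCoeff z) x * powSum (hypCoeff (Complex.I * z)) x
      - powSum (hypCoeff (Complex.I * z)) x * powSum (hypCoeff₂ z) (1 - x) / (4 * sinLim z)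
      + powSum (hypCoeff z) x * powSum (hypCoeff₂ (Complex.I * z)) (1 - x) /
        (4 * sinLim (Complex.I * z)) := by
  rw [closedForm, hypY₁_eq, hypY₁_eq, hypY₁_eq, hypY₁_eq, hypY₂_eq hz hx0 hx1,
    hypY₂_eq (norm_I_mul_lt hz) hx0 hx1, powSum_hypCoeff_one, powSum_hypCoeff_one]

theorem powSum_genCoeff_eq_closedForm {z : ℂ} (hz : ‖z‖ < 1) {x : ℝ} (hx0 : 0 < x) (hx1 : x ≤ 1) :
    powSum (genCoeff z) x = closedForm x z := by
  rw [closedForm_eq hz hx0 hx1]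
  rcases hx1.lt_or_eq with h | rfl
  · exact powSum_genCoeff_eq hz ⟨hx0, h⟩
  have hzw := norm_I_mul_lt hz
  -- At `x = 1` both sides are left limits of the identity on `(0, 1)`.
  have hle : 𝓝[<] (1 : ℝ) ≤ 𝓝[Set.Icc 0 1] 1 := by
    rw [← nhdsWithin_Ioo_eq_nhdsLT (zero_lt_one' ℝ)]
    exact nhdsWithin_mono _ Set.Ioo_subset_Icc_self
  have tS := (continuousOn_powSum (summable_norm_genCoeff hz) 1 (by simp)).tendsto.mono_left hle
  have tf := (continuousOn_powSum (summable_norm_hypCoeff hz) 1 (by simp)).tendsto.mono_left hle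
  have tf' := (continuousOn_powSum (summable_norm_hypCoeff hzw) 1 (by simp)).tendsto.mono_left hle
  have hsub : Tendsto (fun x : ℝ => 1 - x) (𝓝[<] 1) (𝓝 (1 - 1)) :=
    ((continuous_const.sub continuous_id).tendsto 1).mono_left nhdsWithin_le_nhds
  have tU := ((hasDerivAt_hyp₂ hz (x := 1 - 1) (by simp)).continuousAt.tendsto).comp hsub
  have tU' := ((hasDerivAt_hyp₂ hzw (x := 1 - 1) (by simp)).continuousAt.tendsto).comp hsub
  refine tendsto_nhds_unique tS ?_
  have t := (((tf.const_mul (psiG z)).mul tf').sub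
    ((tf'.mul tU).div_const (4 * sinLim z))).add
    ((tf.mul tU').div_const (4 * sinLim (Complex.I * z)))
  refine t.congr' ?_
  rw [← nhdsWithin_Ioo_eq_nhdsLT (zero_lt_one' ℝ)]
  filter_upwards [self_mem_nhdsWithin] with x hx
  exact (powSum_genCoeff_eq hz hx).symm

theorem hasSum_genTerm_closedForm {x : ℝ} {z : ℂ} (hx0 : 0 < x) (hx1 : x ≤ 1) (hz : ‖z‖ < 1) :
    HasSum (genTerm x z) (closedForm x z) := by
  rw [← powSum_genCoeff_eq_closedForm hz hx0 hx1]
  exact hasSum_genTerm hx0.le hx1 hz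

theorem tendsto_closedForm_zero {z : ℂ} (hz : ‖z‖ < 1) :
    Tendsto (fun x : ℝ => closedForm x z) (𝓝[>] 0) (𝓝 (powSum (genCoeff z) 0)) := by
  have h0 : powSum (genCoeff z) 0 = genCoeff z 0 := by
    rw [powSum, tsum_eq_single 0 fun m hm => by simp [hm]]
    simp
  rw [h0]
  refine (tendsto_powSum_zero (norm_genCoeff_le_const hz)).congr' ?_
  filter_upwards [Ioo_mem_nhdsGT one_pos] with x hx
  exact powSum_genCoeff_eq_closedForm hz hx.1 hx.2.le

theorem closedForm_one {z : ℂ} (hz : ‖z‖ < 1) :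
    closedForm 1 z = psiG z * sinLim z * sinLim (Complex.I * z) := by
  have h : ∀ w : ℂ, powSum (hypCoeff₂ w) 0 = 0 := fun w => by
    rw [powSum, tsum_eq_single 0 fun m hm => by simp [hm]]
    simp [hypCoeff₂]
  rw [closedForm_eq hz one_pos le_rfl, sub_self, h, h, powSum_hypCoeff_one, powSum_hypCoeff_one]
  ring

/-! ### Expansions at `x = 1` -/

theorem hasSum_multiZeta_singleton {s : ℕ} (hs : 1 < s) :
    HasSum (fun m : ℕ => (((m : ℝ) + 1) ^ s)⁻¹) (multiZeta 1 [s]) := by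
  have h := (Real.summable_nat_pow_inv.2 hs).hasSum
  have e : multiZeta 1 [s] = ∑' m : ℕ, ((m : ℝ) ^ s)⁻¹ :=
    hasSum_multiZeta_cons (by omega) (by simp) zero_le_one (by simpa [truncZeta] using h)
  rw [e]
  have h2 := (hasSum_nat_add_iff' 1).2 h
  simpa [zero_pow (show s ≠ 0 by omega)] using h2

theorem hasSum_psiG_zeta {z : ℂ} (hz : ‖z‖ < 1) :
    HasSum (fun k : ℕ => z ^ (4 * k + 2) * (multiZeta 1 [4 * k + 3] : ℂ)) (psiG z) := by
  have hz4 : ‖z‖ ^ 4 < 1 := pow_lt_one₀ (norm_nonneg _) hz (by norm_num)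
  have hsq : Summable fun n : ℕ => (((n + 1 : ℕ) : ℝ) ^ 2)⁻¹ :=
    (summable_nat_add_iff 1).2 summable_inv_sq
  have hgeo : Summable fun k : ℕ => (‖z‖ ^ 4) ^ k :=
    summable_geometric_of_lt_one (by positivity) hz4
  have hs : Summable fun p : ℕ × ℕ =>
      z ^ (4 * p.2 + 2) * (((p.1 : ℂ) + 1) ^ (4 * p.2 + 3))⁻¹ := by
    refine Summable.of_norm_bounded
      (g := fun p : ℕ × ℕ => (((p.1 + 1 : ℕ) : ℝ) ^ 2)⁻¹ * (‖z‖ ^ 4) ^ p.2)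
      (hsq.mul_of_nonneg hgeo (fun n => by positivity) fun k => by positivity) fun p => ?_
    rw [norm_mul, norm_inv, norm_pow, norm_pow, norm_natCast_succ, mul_comm, ← pow_mul]
    push_cast
    gcongr ?_⁻¹ * ?_
    · exact pow_le_pow_right₀ (by linarith [Nat.cast_nonneg (α := ℝ) p.1]) (by omega)
    · exact pow_le_pow_of_le_one (norm_nonneg _) hz.le (by omega)
  have h1 : HasSum (fun n : ℕ => (psiTerm z n - psiTerm (Complex.I * z) n) / 4) (∑' p : ℕ × ℕ,
      z ^ (4 * p.2 + 2) * (((p.1 : ℂ) + 1) ^ (4 * p.2 + 3))⁻¹) := by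
    refine hs.hasSum.prod_fiberwise fun n => ?_
    have hn := natCast_succ_ne_zero n
    have hq : ‖z ^ 4 / ((n : ℂ) + 1) ^ 4‖ < 1 := by
      rw [norm_div, norm_pow, norm_pow, norm_natCast_succ]
      refine (div_le_self (by positivity) ?_).trans_lt hz4
      exact one_le_pow₀ (by linarith [Nat.cast_nonneg (α := ℝ) n])
    have hg := (hasSum_geometric_of_norm_lt_one hq).mul_left (z ^ 2 / ((n : ℂ) + 1) ^ 3)
    have e1 := succ_sq_sub_ne_zero hz n
    have e2 := succ_sq_sub_ne_zero (norm_I_mul_lt hz) n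
    rw [I_mul_sq, sub_neg_eq_add] at e2
    -- The two fractions combine over `(n + 1)⁴ - z⁴`, so each term is a geometric series in `z⁴ /
    -- (n + 1)⁴`.
    have e : (psiTerm z n - psiTerm (Complex.I * z) n) / 4 =
        z ^ 2 / ((n : ℂ) + 1) ^ 3 * (1 - z ^ 4 / ((n : ℂ) + 1) ^ 4)⁻¹ := by
      have e3 : (1 - z ^ 4 / ((n : ℂ) + 1) ^ 4) =
          (((n : ℂ) + 1) ^ 2 - z ^ 2) * (((n : ℂ) + 1) ^ 2 + z ^ 2) / ((n : ℂ) + 1) ^ 4 := by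
        field_simp
        ring
      rw [e3, psiTerm, psiTerm, I_mul_sq, sub_neg_eq_add]
      field_simp
      ring
    rw [e]
    refine hg.congr_fun fun k => ?_
    rw [div_pow, ← pow_mul, ← pow_mul, pow_add z, pow_add _ (4 * k) 3]
    field_simp
  have h2 : HasSum (fun k : ℕ => z ^ (4 * k + 2) * (multiZeta 1 [4 * k + 3] : ℂ)) (∑' p : ℕ × ℕ,
      z ^ (4 * p.2 + 2) * (((p.1 : ℂ) + 1) ^ (4 * p.2 + 3))⁻¹) := by
    have h3 : HasSum (fun p : ℕ × ℕ => z ^ (4 * p.1 + 2) * (((p.2 : ℂ) + 1) ^ (4 * p.1 + 3))⁻¹)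
        (∑' p : ℕ × ℕ, z ^ (4 * p.2 + 2) * (((p.1 : ℂ) + 1) ^ (4 * p.2 + 3))⁻¹) :=
      (Equiv.prodComm ℕ ℕ).hasSum_iff (f := fun p : ℕ × ℕ =>
        z ^ (4 * p.2 + 2) * (((p.1 : ℂ) + 1) ^ (4 * p.2 + 3))⁻¹) |>.2 hs.hasSum
    refine h3.prod_fiberwise fun k => ?_
    have h4 := (Complex.hasSum_ofReal.2 (hasSum_multiZeta_singleton
      (s := 4 * k + 3) (by omega))).mul_left (z ^ (4 * k + 2))
    refine h4.congr_fun fun n => ?_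
    push_cast
    rfl
  rw [(hasSum_psiG hz).unique h1]
  exact h2

theorem truncZeta_fours_le (m N : ℕ) : truncZeta (strPow [4] m) N ≤ 2 ^ m := by
  induction m generalizing N with
  | zero => simp [strPow, truncZeta]
  | succ m ih =>
    rw [strPow_succ, List.singleton_append, truncZeta, pow_succ']
    calc ∑ k ∈ range N, ((k : ℝ) ^ 4)⁻¹ * truncZeta (strPow [4] m) k
        ≤ ∑ k ∈ range N, ((k : ℝ) ^ 3)⁻¹ * 2 ^ m := by
          refine sum_le_sum fun k _ => mul_le_mul ?_ (ih k) (truncZeta_nonneg _ _) (by positivity)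
          rcases Nat.eq_zero_or_pos k with rfl | hk
          · simp
          · gcongr
            · exact_mod_cast hk
            · norm_num
      _ ≤ 2 * 2 ^ m := by
          rw [← sum_mul]
          gcongr
          exact sum_range_inv_cube_le N

theorem multiZeta_nil (x : ℝ) : multiZeta x [] = 1 := by
  have : Unique {n : Fin ([] : List ℕ).length → ℕ // StrictAnti n ∧ ∀ j, 0 < n j} :=
    { default := ⟨Fin.elim0, fun i => i.elim0, fun i => i.elim0⟩
      uniq := fun n => Subtype.ext (funext fun i => i.elim0) }
  simp [multiZeta]

theorem tendsto_truncZeta_fours (m : ℕ) :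
    Tendsto (truncZeta (strPow [4] m)) atTop (𝓝 (multiZeta 1 (strPow [4] m))) := by
  cases m with
  | zero =>
    simp only [strPow, List.replicate_zero, List.flatten_nil, multiZeta_nil]
    exact tendsto_const_nhds.congr fun N => by simp [truncZeta]
  | succ m =>
    rw [strPow_succ, List.singleton_append]
    have hs : Summable fun n : ℕ => ((n : ℝ) ^ 4)⁻¹ * truncZeta (strPow [4] m) n := by
      refine Summable.of_nonneg_of_le (fun n => mul_nonneg (by positivity) (truncZeta_nonneg _ _))
        (fun n => mul_le_mul_of_nonneg_left (truncZeta_fours_le m n) (by positivity))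
        ((Real.summable_nat_pow_inv.2 (by norm_num)).mul_right _)
    rw [hasSum_multiZeta_cons (by norm_num) (pos_of_mem_strPow (by simp) m) zero_le_one
      (hs.hasSum.congr_fun fun n => by simp)]
    exact hs.hasSum.tendsto_sum_nat

/-- `truncZeta (strPow [4] m) (N + 1)` is the `m`-th elementary symmetric function of `j⁻⁴` for `1 ≤
j ≤ N`. The induction multiplies by one more factor. -/
theorem hasSum_truncZeta_fours (w : ℂ) (N : ℕ) :
    HasSum (fun m => (-w) ^ m * (truncZeta (strPow [4] m) (N + 1) : ℂ))
      (∏ j ∈ range N, (1 - w / ((j : ℂ) + 1) ^ 4)) := by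
  induction N with
  | zero =>
    have h := hasSum_single (f := fun m => (-w) ^ m * (truncZeta (strPow [4] m) (0 + 1) : ℂ)) 0
      fun m hm => by
        obtain ⟨k, rfl⟩ := Nat.exists_eq_succ_of_ne_zero hm
        rw [Nat.succ_eq_add_one, strPow_succ]
        simp [truncZeta]
    simpa [strPow, truncZeta] using h
  | succ N ih =>
    rw [prod_range_succ, mul_sub, mul_one]
    have h1 := ih.mul_left (-w / ((N : ℂ) + 1) ^ 4)
    have h2 : HasSum (fun m : ℕ => (-w) ^ m * ((truncZeta (strPow [4] m) (N + 1 + 1) : ℂ) -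
        (truncZeta (strPow [4] m) (N + 1) : ℂ)))
        (-w / ((N : ℂ) + 1) ^ 4 * ∏ j ∈ range N, (1 - w / ((j : ℂ) + 1) ^ 4)) := by
      rw [← hasSum_nat_add_iff' 1]
      simp only [sum_range_one]
      have h0 : ∀ K, truncZeta (strPow [4] 0) K = 1 := fun K => by simp [strPow, truncZeta]
      rw [h0, h0, sub_self, mul_zero, sub_zero]
      refine h1.congr_fun fun m => ?_
      rw [strPow_succ, List.singleton_append, truncZeta, truncZeta, sum_range_succ _ (N + 1)]
      push_cast
      rw [pow_succ, div_eq_mul_inv]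
      ring
    have h3 := ih.add h2
    rw [neg_div, neg_mul, ← sub_eq_add_neg, mul_comm (w / _)] at h3
    refine h3.congr_fun fun m => ?_
    ring

theorem sinProd_mul_sinProd_I (z : ℂ) (n : ℕ) : sinProd z n * sinProd (Complex.I * z) n =
    ∏ j ∈ range n, (1 - z ^ 4 / ((j : ℂ) + 1) ^ 4) := by
  rw [sinProd, sinProd, ← prod_mul_distrib]
  refine prod_congr rfl fun j _ => ?_
  have := natCast_succ_ne_zero j
  rw [I_mul_sq]
  field_simp
  ring

/-- Dominated convergence as the truncation is lifted. The bound `2 ^ m` on the truncated sums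
requires `2 ‖z‖⁴ < 1`, which `‖z‖ < 1/2` ensures. -/
theorem hasSum_fours {z : ℂ} (hz : ‖z‖ < 1 / 2) :
    HasSum (fun m => (-z ^ 4) ^ m * (multiZeta 1 (strPow [4] m) : ℂ))
      (sinLim z * sinLim (Complex.I * z)) := by
  have hz1 : ‖z‖ < 1 := by linarith
  have hw : ‖z ^ 4‖ < 1 / 2 := by
    rw [norm_pow]
    calc ‖z‖ ^ 4 ≤ ‖z‖ ^ 1 := pow_le_pow_of_le_one (norm_nonneg _) hz1.le (by norm_num)
      _ < 1 / 2 := by rwa [pow_one]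
  have hb : Summable fun m : ℕ => (2 * ‖z ^ 4‖) ^ m :=
    summable_geometric_of_lt_one (by positivity) (by linarith)
  have hle : ∀ N m : ℕ, ‖(-z ^ 4) ^ m * (truncZeta (strPow [4] m) N : ℂ)‖ ≤ (2 * ‖z ^ 4‖) ^ m := by
    intro N m
    rw [norm_mul, norm_pow, norm_neg, Complex.norm_real,
      Real.norm_of_nonneg (truncZeta_nonneg _ _), mul_pow, mul_comm]
    gcongr
    exact truncZeta_fours_le m N
  have hlim : ∀ m : ℕ, Tendsto (fun N => (-z ^ 4) ^ m * (truncZeta (strPow [4] m) N : ℂ)) atTop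
      (𝓝 ((-z ^ 4) ^ m * (multiZeta 1 (strPow [4] m) : ℂ))) := fun m =>
    ((Complex.continuous_ofReal.tendsto _).comp (tendsto_truncZeta_fours m)).const_mul _
  have h1 := tendsto_tsum_of_dominated_convergence hb hlim
    (Eventually.of_forall fun N m => hle N m)
  have h2 := (tendsto_sinProd hz1).mul (tendsto_sinProd (norm_I_mul_lt hz1))
  have h3 := (tendsto_add_atTop_iff_nat 1).2 h1
  have h4 := tendsto_nhds_unique (h3.congr fun N => by
    rw [(hasSum_truncZeta_fours (z ^ 4) N).tsum_eq, ← sinProd_mul_sinProd_I]) h2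
  rw [← h4]
  refine (Summable.of_norm_bounded hb fun m => ?_).hasSum
  exact le_of_tendsto (hlim m).norm (Eventually.of_forall fun N => hle N m)

/-- With `a = π z`, the product is read off from `2 sin a sin(ia) = cos(a - ia) - cos(a + ia)`.
Since `(a ∓ ia)² = ∓2i a²`, the cosine terms of even index cancel and those of odd index double. -/
theorem hasSum_sinLim_mul {z : ℂ} (hz : ‖z‖ < 1) (hz0 : z ≠ 0) :
    HasSum (fun m : ℕ => (-z ^ 4) ^ m * (2 * 4 ^ m * (Real.pi : ℂ) ^ (4 * m) /
      ((4 * m + 2).factorial : ℂ))) (sinLim z * sinLim (Complex.I * z)) := by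
  set a : ℂ := Real.pi * z with ha
  have hpi : (Real.pi : ℂ) ≠ 0 := by exact_mod_cast Real.pi_ne_zero
  have ha0 : a ≠ 0 := mul_ne_zero hpi hz0
  have e1 : a * sinLim z = Complex.sin a := pi_mul_sinLim hz
  have e2 : Complex.I * a * sinLim (Complex.I * z) = Complex.sin (Complex.I * a) := by
    have := pi_mul_sinLim (norm_I_mul_lt hz)
    rw [show (Real.pi : ℂ) * (Complex.I * z) = Complex.I * a by rw [ha]; ring] at this
    exact this
  have e3 : Complex.cos (a - Complex.I * a) - Complex.cos (a + Complex.I * a) =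
      2 * Complex.I * a ^ 2 * (sinLim z * sinLim (Complex.I * z)) := by
    rw [Complex.cos_sub, Complex.cos_add, ← e1, ← e2]
    ring
  have h1 := (Complex.hasSum_cos (a - Complex.I * a)).sub (Complex.hasSum_cos (a + Complex.I * a))
  rw [e3] at h1
  have p1 : (a - Complex.I * a) ^ 2 = -(2 * Complex.I * a ^ 2) := by
    linear_combination a ^ 2 * Complex.I_sq
  have p2 : (a + Complex.I * a) ^ 2 = 2 * Complex.I * a ^ 2 := by
    linear_combination a ^ 2 * Complex.I_sq
  have hinj : Function.Injective fun m : ℕ => 2 * m + 1 := fun m n h => by simpa using h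
  rw [← hinj.hasSum_iff] at h1
  · have h2 := h1.mul_left ((2 * Complex.I * a ^ 2)⁻¹)
    rw [inv_mul_cancel_left₀ (by simp [ha0])] at h2
    refine h2.congr_fun fun m => ?_
    simp only [Function.comp_apply]
    rw [pow_mul (a - _), pow_mul (a + _), p1, p2, neg_pow (2 * Complex.I * a ^ 2),
      show 2 * (2 * m + 1) = 4 * m + 2 by ring]
    have hodd : (-1 : ℂ) ^ (2 * m + 1) = -1 := by simp [pow_succ, pow_mul]
    rw [hodd, pow_succ (2 * Complex.I * a ^ 2), pow_mul (2 * Complex.I * a ^ 2)]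
    have p3 : (2 * Complex.I * a ^ 2) ^ 2 = -4 * a ^ 4 := by
      linear_combination 4 * a ^ 4 * Complex.I_sq
    have hf : ((4 * m + 2).factorial : ℂ) ≠ 0 := by exact_mod_cast Nat.factorial_ne_zero _
    have hI := Complex.I_ne_zero
    have hb : 2 * Complex.I * a ^ 2 ≠ 0 := by simp [ha0]
    rw [p3, ha, pow_mul (Real.pi : ℂ) 4 m]
    have p4 : (-z ^ 4) ^ m * (2 * 4 ^ m * ((Real.pi : ℂ) ^ 4) ^ m /
        ((4 * m + 2).factorial : ℂ)) = 2 * (-4 * (Real.pi * z) ^ 4) ^ m /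
        ((4 * m + 2).factorial : ℂ) := by
      have : (-4 * (Real.pi * z) ^ 4) = -z ^ 4 * 4 * (Real.pi : ℂ) ^ 4 := by ring
      rw [this, mul_pow, mul_pow]
      ring
    rw [p4, ← ha]
    field_simp
    ring
  · intro n hn
    have hev : Even n := by
      by_contra h
      obtain ⟨m, rfl⟩ := Nat.not_even_iff_odd.1 h
      exact hn ⟨m, rfl⟩
    rw [pow_mul (a - _), pow_mul (a + _), p1, p2, hev.neg_pow (2 * Complex.I * a ^ 2), sub_self]

/-! ### Comparison of coefficients -/

theorem powerSeries_coeff_unique {a b : ℕ → ℂ} {ε : ℝ} (hε : 0 < ε)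
    (h : ∀ w ∈ Set.Ioo 0 ε, ∃ s, HasSum (fun n => (w : ℂ) ^ n * a n) s ∧
      HasSum (fun n => (w : ℂ) ^ n * b n) s) (n : ℕ) : a n = b n := by
  induction n using Nat.strong_induction_on with
  | _ N ih =>
    have hc : ∀ w ∈ Set.Ioo 0 ε, HasSum (fun n => (w : ℂ) ^ n * (a (n + N) - b (n + N))) 0 := by
      intro w hw
      obtain ⟨s, h1, h2⟩ := h w hw
      have h3 := h1.sub h2
      rw [sub_self, ← hasSum_nat_add_iff' N] at h3
      have h4 : ∑ i ∈ range N, ((w : ℂ) ^ i * a i - (w : ℂ) ^ i * b i) = 0 :=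
        sum_eq_zero fun i hi => by rw [ih i (mem_range.1 hi), sub_self]
      rw [h4, sub_zero] at h3
      have hw0 : (w : ℂ) ^ N ≠ 0 := pow_ne_zero _ (by exact_mod_cast hw.1.ne')
      have h5 := h3.mul_left (((w : ℂ) ^ N)⁻¹)
      rw [mul_zero] at h5
      refine h5.congr_fun fun n => ?_
      rw [pow_add]
      field_simp
    have hr : ε / 2 ∈ Set.Ioo 0 ε := ⟨by linarith, by linarith⟩
    -- Rescaling by `ε / 2` makes the coefficients terms of a convergent series, hence bounded, so
    -- the limit at 0 is the constant term.
    set d : ℕ → ℂ := fun n => ((ε / 2 : ℝ) : ℂ) ^ n * (a (n + N) - b (n + N)) with hd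
    obtain ⟨C, hC⟩ := (hc _ hr).summable.tendsto_atTop_zero.norm.bddAbove_range
    have hC' : ∀ m, ‖d m‖ ≤ C := fun m => hC ⟨m, rfl⟩
    have ht := tendsto_powSum_zero hC'
    have h0 : Tendsto (powSum d) (𝓝[>] 0) (𝓝 0) := by
      refine tendsto_const_nhds.congr' ?_
      filter_upwards [Ioo_mem_nhdsGT one_pos] with x hx
      have hx' : x * (ε / 2) ∈ Set.Ioo 0 ε :=
        ⟨mul_pos hx.1 (by linarith), by nlinarith [hx.1, hx.2]⟩
      rw [powSum, ← (hc _ hx').tsum_eq]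
      refine tsum_congr fun n => ?_
      rw [hd]
      push_cast
      ring
    have := tendsto_nhds_unique ht h0
    simpa [hd, sub_eq_zero] using this

theorem genCoeff_cauchy {b : ℕ → ℂ} (hb : ∀ z : ℂ, z ≠ 0 → ‖z‖ < 1 / 2 →
      HasSum (fun m => (z ^ 4) ^ m * b m) (sinLim z * sinLim (Complex.I * z))) (n : ℕ) :
    (-1) ^ n * 4 ^ n * (multiZeta 1 (3 :: strPow [1, 3] n) : ℂ) =
      ∑ k ∈ range (n + 1), (multiZeta 1 [4 * k + 3] : ℂ) * b (n - k) := by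
  refine powerSeries_coeff_unique (ε := 1 / 16)
    (a := fun n => (-1) ^ n * 4 ^ n * (multiZeta 1 (3 :: strPow [1, 3] n) : ℂ))
    (b := fun n => ∑ k ∈ range (n + 1), (multiZeta 1 [4 * k + 3] : ℂ) * b (n - k))
    (by norm_num) (fun w hw => ?_) n
  -- All series become power series in `w = z⁴` once `z²` is divided out, so a real fourth root
  -- suffices; `w < 1/16` gives `y < 1/2`.
  obtain ⟨y, hy0, hy⟩ : ∃ y : ℝ, 0 < y ∧ y ^ 4 = w := by
    refine ⟨√(√w), Real.sqrt_pos.2 (Real.sqrt_pos.2 hw.1), ?_⟩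
    rw [show 4 = 2 * 2 by rfl, pow_mul, Real.sq_sqrt (Real.sqrt_nonneg _), Real.sq_sqrt hw.1.le]
  have hy2 : y < 1 / 2 := by
    refine lt_of_pow_lt_pow_left₀ 4 (by norm_num) ?_
    rw [hy]
    norm_num
    exact lt_of_lt_of_eq hw.2 (by norm_num)
  have hyn : ‖(y : ℂ)‖ < 1 / 2 := by rwa [Complex.norm_real, Real.norm_of_nonneg hy0.le]
  have hyn1 : ‖(y : ℂ)‖ < 1 := by linarith
  have hyc : (y : ℂ) ≠ 0 := by exact_mod_cast hy0.ne'
  have hwc : (w : ℂ) = (y : ℂ) ^ 4 := by rw [← hy]; push_cast; rfl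
  rw [hwc]
  have hinv : ((y : ℂ) ^ 2)⁻¹ * (y : ℂ) ^ 2 = 1 := inv_mul_cancel₀ (pow_ne_zero 2 hyc)
  have hZ : HasSum (fun k : ℕ => ((y : ℂ) ^ 4) ^ k * (multiZeta 1 [4 * k + 3] : ℂ))
      (((y : ℂ) ^ 2)⁻¹ * psiG y) := by
    refine ((hasSum_psiG_zeta hyn1).mul_left (((y : ℂ) ^ 2)⁻¹)).congr_fun fun k => ?_
    rw [← pow_mul, pow_add]
    linear_combination (-(y : ℂ) ^ (4 * k) * (multiZeta 1 [4 * k + 3] : ℂ)) * hinv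
  have hB := hb y hyc hyn
  have hA := (hasSum_genTerm_closedForm one_pos le_rfl hyn1).mul_left (((y : ℂ) ^ 2)⁻¹)
  rw [closedForm_one hyn1] at hA
  refine ⟨_, hA.congr_fun fun m => ?_, ?_⟩
  · rw [genTerm, ← pow_mul, pow_add]
    linear_combination (-(-1) ^ m * (y : ℂ) ^ (4 * m) * 4 ^ m *
      (multiZeta 1 (3 :: strPow [1, 3] m) : ℂ)) * hinv
  · have hn1 := hZ.summable.norm
    have hn2 := hB.summable.norm
    have hprod := tsum_mul_tsum_eq_tsum_sum_range_of_summable_norm hn1 hn2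
    have hsum := (summable_norm_sum_mul_range_of_summable_norm hn1 hn2).of_norm.hasSum
    rw [← hprod, hZ.tsum_eq, hB.tsum_eq, ← mul_assoc] at hsum
    rw [← mul_assoc, ← mul_assoc]
    refine hsum.congr_fun fun m => ?_
    rw [mul_sum]
    refine sum_congr rfl fun k hk => ?_
    have hk' : k ≤ m := Nat.lt_succ_iff.1 (mem_range.1 hk)
    rw [← Nat.add_sub_cancel' hk', pow_add, Nat.add_sub_cancel' hk']
    ring

theorem multiZeta_eq_cauchy {b : ℕ → ℝ} (hb : ∀ z : ℂ, z ≠ 0 → ‖z‖ < 1 / 2 →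
      HasSum (fun m => (-z ^ 4) ^ m * (b m : ℂ)) (sinLim z * sinLim (Complex.I * z))) (n : ℕ) :
    multiZeta 1 (3 :: strPow [1, 3] n) = (1 / 4 ^ n) * ∑ k ∈ range (n + 1),
      (-1) ^ k * multiZeta 1 [4 * k + 3] * b (n - k) := by
  have h := genCoeff_cauchy (b := fun m => (-1) ^ m * (b m : ℂ)) (fun z hz0 hz =>
    (hb z hz0 hz).congr_fun fun m => by rw [neg_pow]; ring) n
  have h' : (-1) ^ n * 4 ^ n * multiZeta 1 (3 :: strPow [1, 3] n) =
      ∑ k ∈ range (n + 1), multiZeta 1 [4 * k + 3] * ((-1) ^ (n - k) * b (n - k)) := by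
    exact_mod_cast h
  have hsq : ((-1 : ℝ) ^ n) * (-1) ^ n = 1 := by rw [← mul_pow]; simp
  have h4 : (4 : ℝ) ^ n ≠ 0 := by positivity
  have e : ∑ k ∈ range (n + 1), (-1) ^ k * multiZeta 1 [4 * k + 3] * b (n - k) =
      (-1) ^ n * ∑ k ∈ range (n + 1), multiZeta 1 [4 * k + 3] * ((-1) ^ (n - k) * b (n - k)) := by
    rw [mul_sum]
    refine sum_congr rfl fun k hk => ?_
    have hk' : k ≤ n := Nat.lt_succ_iff.1 (mem_range.1 hk)
    have hs : (-1 : ℝ) ^ n * (-1) ^ (n - k) = (-1) ^ k := by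
      obtain ⟨j, rfl⟩ := Nat.exists_eq_add_of_le hk'
      have hj : ((-1 : ℝ) ^ j) * (-1) ^ j = 1 := by rw [← mul_pow]; simp
      rw [Nat.add_sub_cancel_left, pow_add, mul_assoc, hj, mul_one]
    rw [← hs]
    ring
  rw [e, ← h']
  field_simp
  linear_combination (-multiZeta 1 (3 :: strPow [1, 3] n)) * hsq

theorem mainTheorem3 :
    (∀ (x : ℝ) (z : ℂ), 0 < x → x ≤ 1 → ‖z‖ < 1 →
      HasSum (genTerm x z) (closedForm x z)) ∧
    (∀ z : ℂ, ‖z‖ < 1 →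
      ∃ L : ℂ, HasSum (genTerm 0 z) L ∧
        Filter.Tendsto (fun x : ℝ => closedForm x z) (nhdsWithin 0 (Set.Ioi 0)) (nhds L)) ∧
    (∀ n : ℕ,
      multiZeta 1 (3 :: strPow [1, 3] n) =
        (1 / 4 ^ n) * ∑ k ∈ Finset.range (n + 1),
          (-1) ^ k * multiZeta 1 [4 * k + 3] * multiZeta 1 (strPow [4] (n - k))) ∧
    (∀ n : ℕ,
      multiZeta 1 (3 :: strPow [1, 3] n) =
        ∑ k ∈ Finset.range (n + 1),
          2 * Real.pi ^ (4 * k) / (Nat.factorial (4 * k + 2) : ℝ) * (-1 / 4) ^ (n - k) *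
            multiZeta 1 [4 * (n - k) + 3]) := by
  refine ⟨fun x z hx0 hx1 hz => hasSum_genTerm_closedForm hx0 hx1 hz,
    fun z hz => ⟨_, hasSum_genTerm le_rfl zero_le_one hz, tendsto_closedForm_zero hz⟩,
    fun n => multiZeta_eq_cauchy (b := fun m => multiZeta 1 (strPow [4] m))
      (fun z _ hz => hasSum_fours hz) n, fun n => ?_⟩
  rw [multiZeta_eq_cauchy (b := fun m => 2 * 4 ^ m * Real.pi ^ (4 * m) /
      ((4 * m + 2).factorial : ℝ)) (fun z hz0 hz => by
        refine (hasSum_sinLim_mul (by linarith) hz0).congr_fun fun m => ?_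
        push_cast
        rfl) n, ← sum_range_reflect, mul_sum]
  refine sum_congr rfl fun k hk => ?_
  have hk' : k ≤ n := Nat.lt_succ_iff.1 (mem_range.1 hk)
  rw [show n + 1 - 1 - k = n - k by omega, Nat.sub_sub_self hk', div_pow]
  obtain ⟨j, rfl⟩ := Nat.exists_eq_add_of_le hk'
  rw [Nat.add_sub_cancel_left, pow_add]
  field_simp

end
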